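/- A \emph{scaled simplicial set} is a pair $(X,T)$ of a simplicial set $X$ and a set $T$ of $2$-simplices of $X$, called \emph{thin}, that contains the degenerate ones; for a set $T$ of triangles, $(X,T)$ also denotes the scaled simplicial set whose thin triangles are those of $T$ and the degenerate ones. An \emph{$\infty$-bicategory} is a scaled simplicial set that admits extensions along the following maps: (i) $(\Lambda^n_i,\Delta^{\{i-1,i,i+1\}})\to(\Delta^n,\Delta^{\{i-1,i,i+1\}})$ for $0<i<n$; (ii) $(\Delta^4,T)\to(\Delta^4,T\cup\{\Delta^{\{0,3,4\}},\Delta^{\{0,1,4\}}\})$ with $T=\{\Delta^{\{0,2,4\}},\Delta^{\{1,2,3\}},\Delta^{\{0,1,3\}},\Delta^{\{1,3,4\}},\Delta^{\{0,1,2\}}\}$; (iii) $(\Lambda^n_0\amalg_{\Delta^{\{0,1\}}}\Delta^0,\Delta^{\{0,1,n\}})\to(\Delta^n\amalg_{\Delta^{\{0,1\}}}\Delta^0,\Delta^{\{0,1,n\}})$ for $n\ge 3$. An edge of an $\infty$-bicategory $\mathcal{C}$ is \emph{invertible} if it becomes an isomorphism in the homotopy category of the $\infty$-category $\mathcal{C}^{\mathrm{th}}$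 that consists of the simplices of $\mathcal{C}$ all of whose triangles are thin. The \emph{Gray product} $(X,T_X)\otimes(Y,T_Y)$ is the simplicial set $X\times Y$ in which a triangle $(\alpha,\beta)$ is thin if and only if $\alpha\in T_X$, $\beta\in T_Y$, and either $\alpha$ and its edge $\alpha|_{\Delta^{\{1,2\}}}$ are both degenerate or $\beta$ and its edge $\beta|_{\Delta^{\{0,1\}}}$ are both degenerate. A map of scaled simplicial sets is a \emph{bicategorical equivalence} if it is a weak equivalence of Lurie's bicategorical model structure (whose cofibrations are the monomorphisms and whose fibrant objects are the $\infty$-bicategories); that is, if it induces an equivalence $\mathfrak{C}^{\mathrm{sc}}[X]\to\mathfrak{C}^{\mathrm{sc}}[Y]$ of categories enriched in marked simplicial sets, where $\mathfrak{C}^{\mathrm{sc}}[X]$ is the simplicial category $\mathfrak{C}[X]$ in which the marked edges of the mapping objects are the composites of degenerate edges and of the edges given by thin triangles. \textbf{Proposition.} Let $\mathcal{C}=(\overline{\mathcal{C}},T_{\mathcal{C}})$ and $\mathcal{D}=(\overline{\mathcal{D}},T_{\mathcal{D}})$ be two $\infty$-bicategories. Let $T_{\simeq}\subseteq T_{\mathcal{C}}\times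 T_{\mathcal{D}}$ denote the subset of those triangles $(\alpha,\beta)$ such that either $\alpha|_{\Delta^{\{1,2\}}}$ is invertible in $\mathcal{C}$ or $\beta|_{\Delta^{\{0,1\}}}$ is invertible in $\mathcal{D}$. Then the map \[ \mathcal{C}\otimes\mathcal{D}\to(\overline{\mathcal{C}}\times\overline{\mathcal{D}},T_{\simeq}) \] that is the identity on underlying simplicial sets is a bicategorical equivalence. -/

import Mathlib

open CategoryTheory MonoidalCategory CartesianMonoidalCategory Opposite

universe u

section

open Simplicial

/-! ### Homotopy theory of simplicial sets -/

namespace SSet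

/-- An edge of a simplicial set is invertible in the homotopy category if its class in
`ho(X)` is an isomorphism. (For an `∞`-category `X`, these edges are the equivalences.) -/
def IsEquivalenceEdge {X : SSet.{u}} (e : X _⦋1⦌) : Prop :=
  IsIso (Truncated.HomotopyCategory.homMk (Edge.mk' e).toTruncated)

theorem isEquivalenceEdge_of_degenerate {X : SSet.{u}} {e : X _⦋1⦌}
    (he : e ∈ X.degenerate 1) : IsEquivalenceEdge e := by
  rw [degenerate_eq_iUnion_range_σ] at he
  simp only [Set.mem_iUnion, Set.mem_range] at he
  obtain ⟨i, x, rfl⟩ := he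
  obtain rfl : i = 0 := Fin.fin_one_eq_zero i
  have h : Arrow.mk (Truncated.HomotopyCategory.homMk
      (Edge.mk' (X.σ (0 : Fin 1) x)).toTruncated) =
      Arrow.mk (Truncated.HomotopyCategory.homMk (Edge.id x).toTruncated) :=
    Truncated.HomotopyCategory.congr_arrowMk_homMk _ _ rfl
  have h' : IsIso (Truncated.HomotopyCategory.homMk (Edge.id x).toTruncated) := by
    have := Truncated.HomotopyCategory.homMk_id (V := (truncation 2).obj X) x
    exact (congrArg IsIso this).mpr inferInstance
  exact (MorphismProperty.arrow_mk_mem_toSet_iff (.isomorphisms _) _).1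
    (h ▸ (MorphismProperty.arrow_mk_mem_toSet_iff (.isomorphisms _) _).2 h')

/-- The two inclusions `X ⟶ X × J`, where `J` is the nerve of the walking isomorphism. -/
def cylinderIncl (X : SSet.{u}) (j : coherentIso.{u} _⦋0⦌) : X ⟶ X ⊗ coherentIso.{u} :=
  lift (𝟙 X) (const j)

/-- Two maps are `J`-homotopic if they are the two ends of a map `X × J ⟶ Y`, where `J` is the
nerve of the walking isomorphism. -/
def JHomotopic {X Y : SSet.{u}} (f g : X ⟶ Y) : Prop :=
  ∃ H : X ⊗ coherentIso.{u} ⟶ Y,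
    cylinderIncl X coherentIso.x₀ ≫ H = f ∧ cylinderIncl X coherentIso.x₁ ≫ H = g

/-- A map of simplicial sets is a `J`-homotopy equivalence. Between `∞`-categories, this says
exactly that the map is an equivalence of `∞`-categories. -/
def IsJHomotopyEquivalence {X Y : SSet.{u}} (f : X ⟶ Y) : Prop :=
  ∃ g : Y ⟶ X, JHomotopic (𝟙 X) (f ≫ g) ∧ JHomotopic (𝟙 Y) (g ≫ f)

/-- The set of vertices of a simplicial set. -/
abbrev Vertex (X : SSet.{u}) : Type u := X _⦋0⦌

/-- The `i`-th vertex of a simplex. -/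
def vtx {X : SSet.{u}} {m : ℕ} (s : X _⦋m⦌) (i : Fin (m + 1)) : X _⦋0⦌ :=
  X.map (SimplexCategory.const ⦋0⦌ ⦋m⦌ i).op s

theorem vtx_app {X Y : SSet.{u}} (f : X ⟶ Y) {m : ℕ} (s : X _⦋m⦌) (i : Fin (m + 1)) :
    vtx (f.app _ s) i = f.app _ (vtx s i) :=
  (NatTrans.naturality_apply f _ s).symm

theorem app_mem_degenerate {X Y : SSet.{u}} (f : X ⟶ Y) {n : ℕ} {s : X _⦋n⦌}
    (hs : s ∈ X.degenerate n) : f.app _ s ∈ Y.degenerate n :=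
  degenerate_app_apply hs f

end SSet

/-! ### Marked simplicial sets -/

/-- A marked simplicial set: a simplicial set with a set of marked edges containing the
degenerate ones. -/
structure MarkedSSet : Type (u + 1) where
  toSSet : SSet.{u}
  marked : Set (toSSet _⦋1⦌)
  degenerate_le : toSSet.degenerate 1 ⊆ marked

namespace MarkedSSet

/-- A map of marked simplicial sets. -/
@[ext]
structure Hom (X Y : MarkedSSet.{u}) : Type u where
  hom : X.toSSet ⟶ Y.toSSet
  map_marked : ∀ e ∈ X.marked, hom.app _ e ∈ Y.marked

instance : Category MarkedSSet.{u} where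
  Hom := Hom
  id X := ⟨𝟙 _, fun _ h ↦ h⟩
  comp f g := ⟨f.hom ≫ g.hom, fun _ h ↦ g.map_marked _ (f.map_marked _ h)⟩

@[ext]
theorem hom_ext {X Y : MarkedSSet.{u}} {f g : X ⟶ Y} (h : f.hom = g.hom) : f = g :=
  Hom.ext h

/-- The marking by the degenerate edges only. -/
def flat (X : SSet.{u}) : MarkedSSet.{u} := ⟨X, X.degenerate 1, le_rfl⟩

/-- The product of marked simplicial sets. -/
def prod (X Y : MarkedSSet.{u}) : MarkedSSet.{u} where
  toSSet := X.toSSet ⊗ Y.toSSet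
  marked := {e | (fst X.toSSet Y.toSSet).app _ e ∈ X.marked ∧
    (snd X.toSSet Y.toSSet).app _ e ∈ Y.marked}
  degenerate_le _ he := ⟨X.degenerate_le (SSet.app_mem_degenerate _ he),
    Y.degenerate_le (SSet.app_mem_degenerate _ he)⟩

/-- The map of products induced by a map of simplicial sets (with flat markings) and a map of
marked simplicial sets. -/
def prodMap {K L : SSet.{u}} (k : K ⟶ L) {X Y : MarkedSSet.{u}} (f : X ⟶ Y) :
    (flat K).prod X ⟶ (flat L).prod Y where
  hom := k ⊗ₘ f.hom
  map_marked _ he := ⟨SSet.app_mem_degenerate k he.1, f.map_marked _ he.2⟩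

/-- The simplicial set of maps `X ⟶ Z`: its `n`-simplices are the maps of marked simplicial sets
from the product of `X` with the standard `n`-simplex (marked by its degenerate edges) to `Z`. -/
def mapFlat (X Z : MarkedSSet.{u}) : SSet.{u} where
  obj n := (flat (SSet.stdSimplex.obj n.unop)).prod X ⟶ Z
  map θ := ↾fun φ ↦ prodMap (SSet.stdSimplex.map θ.unop) (𝟙 X) ≫ φ
  map_id _ := by
    apply ConcreteCategory.hom_ext
    intro φ
    apply hom_ext
    change (SSet.stdSimplex.map (𝟙 _) ⊗ₘ 𝟙 X.toSSet) ≫ φ.hom = φ.hom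
    exact (congrArg (fun k ↦ (k ⊗ₘ 𝟙 X.toSSet) ≫ φ.hom) (SSet.stdSimplex.map_id _)).trans <|
      (congrArg (· ≫ φ.hom) (id_tensorHom_id _ _)).trans (Category.id_comp _)
  map_comp θ θ' := by
    apply ConcreteCategory.hom_ext
    intro φ
    apply hom_ext
    change (SSet.stdSimplex.map (θ'.unop ≫ θ.unop) ⊗ₘ 𝟙 X.toSSet) ≫ φ.hom =
      (SSet.stdSimplex.map θ'.unop ⊗ₘ 𝟙 X.toSSet) ≫
        (SSet.stdSimplex.map θ.unop ⊗ₘ 𝟙 X.toSSet) ≫ φ.hom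
    exact congrArg (fun k ↦ (k ⊗ₘ 𝟙 X.toSSet) ≫ φ.hom) (SSet.stdSimplex.map_comp _ _)

/-- Precomposition with a map of marked simplicial sets. -/
def mapFlatPrecomp {X Y : MarkedSSet.{u}} (f : X ⟶ Y) (Z : MarkedSSet.{u}) :
    mapFlat Y Z ⟶ mapFlat X Z where
  app n := ↾fun φ ↦ prodMap (𝟙 (SSet.stdSimplex.obj n.unop)) f ≫ φ
  naturality n n' θ := by
    apply ConcreteCategory.hom_ext
    intro φ
    apply hom_ext
    change (𝟙 (SSet.stdSimplex.obj n'.unop) ⊗ₘ f.hom) ≫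
        (SSet.stdSimplex.map θ.unop ⊗ₘ 𝟙 Y.toSSet) ≫ φ.hom =
      (SSet.stdSimplex.map θ.unop ⊗ₘ 𝟙 X.toSSet) ≫
        (𝟙 (SSet.stdSimplex.obj n.unop) ⊗ₘ f.hom) ≫ φ.hom
    rfl

/-- The marking of an `∞`-category by its equivalences. -/
def natural (Z : SSet.{u}) : MarkedSSet.{u} :=
  ⟨Z, {e | SSet.IsEquivalenceEdge e}, fun _ he ↦ SSet.isEquivalenceEdge_of_degenerate he⟩

/-- Marked categorical equivalences, the weak equivalences of the model structure on marked
simplicial sets: the maps `X ⟶ Y` such that, for every `∞`-category `Z` (marked by its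
equivalences), restriction from maps `Y ⟶ Z` to maps `X ⟶ Z` is an equivalence of
`∞`-categories. -/
def markedEquivalences : MorphismProperty MarkedSSet.{u} := fun _ _ f ↦
  ∀ (Z : SSet.{u}) [SSet.Quasicategory Z],
    SSet.IsJHomotopyEquivalence (mapFlatPrecomp f (natural Z))

/-- The marked simplicial set with one simplex in every dimension, the monoidal unit. -/
def point : MarkedSSet.{u} := flat (Δ[0])

/-- The map from the point corresponding to a vertex. -/
def ofVertex (X : MarkedSSet.{u}) (x : X.toSSet _⦋0⦌) : point ⟶ X where
  hom := SSet.yonedaEquiv.symm x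
  map_marked _ he := X.degenerate_le (SSet.app_mem_degenerate _ he)

/-- Two vertices of a marked simplicial set are homotopic if the corresponding maps from the
point become equal in the homotopy category of marked simplicial sets, that is, in the
localization of marked simplicial sets at the marked categorical equivalences. -/
def HomotopicVertices {X : MarkedSSet.{u}} (x y : X.toSSet _⦋0⦌) : Prop :=
  markedEquivalences.{u}.Q.map (X.ofVertex x) = markedEquivalences.{u}.Q.map (X.ofVertex y)

end MarkedSSet

/-! ### Scaled simplicial sets -/

/-- A scaled simplicial set: a simplicial set with a set of thin triangles containing the
degenerate ones. -/
structure ScaledSSet : Type (u + 1) where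
  toSSet : SSet.{u}
  thin : Set (toSSet _⦋2⦌)
  degenerate_le : toSSet.degenerate 2 ⊆ thin

namespace ScaledSSet

/-- A map of scaled simplicial sets. -/
@[ext]
structure Hom (X Y : ScaledSSet.{u}) : Type u where
  hom : X.toSSet ⟶ Y.toSSet
  map_thin : ∀ t ∈ X.thin, hom.app _ t ∈ Y.thin

instance : Category ScaledSSet.{u} where
  Hom := Hom
  id X := ⟨𝟙 _, fun _ h ↦ h⟩
  comp f g := ⟨f.hom ≫ g.hom, fun _ h ↦ g.map_thin _ (f.map_thin _ h)⟩

/-- The scaled simplicial set `(X, T)`: a triangle is thin if it is in `T` or degenerate. -/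
def ofTriangles (X : SSet.{u}) (T : Set (X _⦋2⦌)) : ScaledSSet.{u} :=
  ⟨X, T ∪ X.degenerate 2, Set.subset_union_right⟩

/-- A map of simplicial sets carrying `T` into `T'` is a map `(X, T) ⟶ (Y, T')`. -/
def homOfTriangles {X Y : SSet.{u}} (f : X ⟶ Y) (T : Set (X _⦋2⦌)) (T' : Set (Y _⦋2⦌))
    (h : ∀ t ∈ T, f.app _ t ∈ T') : ofTriangles X T ⟶ ofTriangles Y T' where
  hom := f
  map_thin t ht := ht.elim (fun ht ↦ Or.inl (h t ht))
    (fun ht ↦ Or.inr (SSet.app_mem_degenerate f ht))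

/-! ### Generating anodyne maps and `∞`-bicategories -/

/-- The triangle of the standard `n`-simplex with vertices `a`, `b`, `c`, as a one-element set. -/
def tri (n a b c : ℕ) : Set ((Δ[n] : SSet.{u}) _⦋2⦌) :=
  {t | (t 0 : ℕ) = a ∧ (t 1 : ℕ) = b ∧ (t 2 : ℕ) = c}

/-- The set `T|_A` of the triangles of a subcomplex `A` that belong to `T`. -/
def restrict {X : SSet.{u}} (A : X.Subcomplex) (T : Set (X _⦋2⦌)) :
    Set (A.toSSet _⦋2⦌) :=
  {t | A.ι.app _ t ∈ T}

/-- The inclusion of a horn into the standard simplex, with the scalings given by a set of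
triangles of the simplex. -/
def hornIncl (n : ℕ) (i : Fin (n + 1)) (T : Set ((Δ[n] : SSet.{u}) _⦋2⦌)) :
    ofTriangles Λ[n, i].toSSet (restrict Λ[n, i] T) ⟶ ofTriangles Δ[n] T :=
  homOfTriangles Λ[n, i].ι _ _ fun _ ht ↦ ht

/-- Five triangles of the standard `4`-simplex. -/
def satTriangles : Set ((Δ[4] : SSet.{u}) _⦋2⦌) :=
  tri 4 0 2 4 ∪ tri 4 1 2 3 ∪ tri 4 0 1 3 ∪ tri 4 1 3 4 ∪ tri 4 0 1 2

/-- The identity of the standard `4`-simplex, as a map of scaled simplicial sets adding the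
triangles `034` and `014` to `satTriangles`. -/
def satIncl : ofTriangles.{u} Δ[4] satTriangles ⟶
    ofTriangles Δ[4] (satTriangles ∪ (tri 4 0 3 4 ∪ tri 4 0 1 4)) :=
  homOfTriangles (𝟙 _) _ _ fun _ ht ↦ Or.inl ht

/-- The edge `01` of the standard `n`-simplex. -/
def edge01 (n : ℕ) (hn : 3 ≤ n) : (Δ[n] : SSet.{u}).Subcomplex :=
  SSet.stdSimplex.face {⟨0, by omega⟩, ⟨1, by omega⟩}

theorem edge01_le_horn (n : ℕ) (hn : 3 ≤ n) : edge01.{u} n hn ≤ Λ[n, 0] := by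
  refine le_trans ?_ (SSet.face_le_horn (⟨2, by omega⟩ : Fin (n + 1)) 0
    (by simp [Fin.ext_iff]))
  rw [edge01, SSet.stdSimplex.face_le_face_iff]
  intro k hk
  simp only [Finset.mem_insert, Finset.mem_singleton] at hk
  rcases hk with rfl | rfl <;> simp [Fin.ext_iff]

/-- The simplicial set obtained from a simplicial set containing the edge `01` of the standard
`n`-simplex by collapsing this edge to a point. -/
noncomputable abbrev collapse (n : ℕ) (hn : 3 ≤ n) {A : (Δ[n] : SSet.{u}).Subcomplex}
    (h : edge01 n hn ≤ A) : SSet.{u} :=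
  Limits.pushout (SSet.Subcomplex.homOfLE h)
    (SSet.stdSimplex.isTerminalObj₀.from (edge01.{u} n hn).toSSet)

/-- The map from the horn `0` of the standard `n`-simplex, with the edge `01` collapsed, to the
standard `n`-simplex with the edge `01` collapsed. -/
noncomputable def collapseIncl (n : ℕ) (hn : 3 ≤ n) :
    collapse.{u} n hn (edge01_le_horn n hn) ⟶
      Limits.pushout (edge01.{u} n hn).ι
        (SSet.stdSimplex.isTerminalObj₀.from (edge01.{u} n hn).toSSet) :=
  Limits.pushout.desc (Λ[n, 0].ι ≫ Limits.pushout.inl _ _) (Limits.pushout.inr _ _)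
    (by rw [← Category.assoc, SSet.Subcomplex.homOfLE_ι, Limits.pushout.condition])

/-- `collapseIncl` as a map of scaled simplicial sets, both sides being scaled by the image of
the triangle `01n`. -/
noncomputable def outerHornIncl (n : ℕ) (hn : 3 ≤ n) :
    ofTriangles.{u} _ ((Limits.pushout.inl (SSet.Subcomplex.homOfLE (edge01_le_horn.{u} n hn))
        (SSet.stdSimplex.isTerminalObj₀.from (edge01.{u} n hn).toSSet)).app (op ⦋2⦌) ''
          restrict Λ[n, 0] (tri n 0 1 n)) ⟶
      ofTriangles _ ((Limits.pushout.inl (edge01.{u} n hn).ι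
        (SSet.stdSimplex.isTerminalObj₀.from (edge01.{u} n hn).toSSet)).app (op ⦋2⦌) ''
          tri n 0 1 n) :=
  homOfTriangles (collapseIncl n hn) _ _ (by
    rintro _ ⟨t, ht, rfl⟩
    refine ⟨Λ[n, 0].ι.app _ t, ht, ?_⟩
    have h : Limits.pushout.inl (SSet.Subcomplex.homOfLE (edge01_le_horn.{u} n hn))
        (SSet.stdSimplex.isTerminalObj₀.from (edge01.{u} n hn).toSSet) ≫ collapseIncl n hn =
        Λ[n, 0].ι ≫ Limits.pushout.inl _ _ := Limits.pushout.inl_desc _ _ _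
    exact (ConcreteCategory.congr_hom (NatTrans.congr_app h (op ⦋2⦌)) t).symm)

/-- The generating anodyne maps. In the first case `n ≥ 2` is automatic. -/
inductive GeneratingAnodyne : MorphismProperty ScaledSSet.{u} where
  /-- the inclusions of inner horns, scaled by the triangle `i - 1, i, i + 1` -/
  | innerHorn (n : ℕ) (i : Fin (n + 1)) (h₀ : 0 < i.val) (h₁ : i.val < n) :
      GeneratingAnodyne (hornIncl n i (tri n (i.val - 1) i.val (i.val + 1)))
  /-- the saturation map of the `4`-simplex -/
  | saturation : GeneratingAnodyne satIncl
  /-- the inclusions of left outer horns with collapsed initial edge, scaled by `01n` -/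
  | outerHorn (n : ℕ) (hn : 3 ≤ n) : GeneratingAnodyne (outerHornIncl n hn)

/-- An `∞`-bicategory is a scaled simplicial set that admits extensions along the generating
anodyne maps. -/
def IsInftyBicategory (X : ScaledSSet.{u}) : Prop :=
  ∀ ⦃K L : ScaledSSet.{u}⦄ (i : K ⟶ L), GeneratingAnodyne i →
    ∀ f : K ⟶ X, ∃ g : L ⟶ X, i ≫ g = f

/-! ### Invertible edges -/

/-- The core of a scaled simplicial set: the simplices all of whose triangles are thin. -/
def core (X : ScaledSSet.{u}) : X.toSSet.Subcomplex where
  obj n := {s | ∀ φ : ⦋2⦌ ⟶ n.unop, X.toSSet.map φ.op s ∈ X.thin}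
  map {n n'} θ s hs φ := by
    have := hs (φ ≫ θ.unop)
    rwa [op_comp, Functor.map_comp_apply] at this

theorem mem_core_edge (X : ScaledSSet.{u}) (e : X.toSSet _⦋1⦌) : e ∈ X.core.obj (op ⦋1⦌) :=
  fun φ ↦ X.degenerate_le ⟨1, by omega, φ, e, rfl⟩

/-- An edge (of an `∞`-bicategory) is invertible if it is invertible in the homotopy category
of the core. -/
def IsInvertible (X : ScaledSSet.{u}) (e : X.toSSet _⦋1⦌) : Prop :=
  SSet.IsEquivalenceEdge (X := X.core.toSSet) ⟨e, X.mem_core_edge e⟩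

theorem isInvertible_of_degenerate (X : ScaledSSet.{u}) {e : X.toSSet _⦋1⦌}
    (he : e ∈ X.toSSet.degenerate 1) : X.IsInvertible e :=
  SSet.isEquivalenceEdge_of_degenerate ((X.core.mem_degenerate_iff _).2 he)

/-! ### The Gray product, and its variant with invertible legs -/

/-- A triangle degenerates along `12` if it and its edge `12` are degenerate. -/
def DegeneratesAlong12 {X : SSet.{u}} (s : X _⦋2⦌) : Prop :=
  s ∈ X.degenerate 2 ∧ X.δ 0 s ∈ X.degenerate 1

/-- A triangle degenerates along `01` if it and its edge `01` are degenerate. -/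
def DegeneratesAlong01 {X : SSet.{u}} (s : X _⦋2⦌) : Prop :=
  s ∈ X.degenerate 2 ∧ X.δ 2 s ∈ X.degenerate 1

/-- The thin triangles of the Gray product. -/
def grayTriangles (X Y : ScaledSSet.{u}) : Set ((X.toSSet ⊗ Y.toSSet : SSet.{u}) _⦋2⦌) :=
  {s | ((fst X.toSSet Y.toSSet).app _ s ∈ X.thin ∧ (snd X.toSSet Y.toSSet).app _ s ∈ Y.thin) ∧
    (DegeneratesAlong12 ((fst X.toSSet Y.toSSet).app _ s) ∨
      DegeneratesAlong01 ((snd X.toSSet Y.toSSet).app _ s))}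

theorem degenerate_le_grayTriangles (X Y : ScaledSSet.{u}) :
    (X.toSSet ⊗ Y.toSSet : SSet.{u}).degenerate 2 ⊆ grayTriangles X Y := by
  intro s hs
  have h₁ := SSet.app_mem_degenerate (fst X.toSSet Y.toSSet) hs
  have h₂ := SSet.app_mem_degenerate (snd X.toSSet Y.toSSet) hs
  refine ⟨⟨X.degenerate_le h₁, Y.degenerate_le h₂⟩, ?_⟩
  rw [SSet.degenerate_eq_iUnion_range_σ] at hs
  simp only [Set.mem_iUnion, Set.mem_range] at hs
  obtain ⟨i, e, rfl⟩ := hs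
  fin_cases i
  · right
    refine ⟨h₂, ?_⟩
    have : SimplicialObject.δ Y.toSSet 2 ((snd X.toSSet Y.toSSet).app (op ⦋2⦌)
        ((X.toSSet ⊗ Y.toSSet : SSet.{u}).σ 0 e)) =
        Y.toSSet.σ 0 (Y.toSSet.δ 1 ((snd X.toSSet Y.toSSet).app (op ⦋1⦌) e)) :=
      ConcreteCategory.congr_hom (Y.toSSet.δ_comp_σ_of_gt (i := 1) (j := 0) (by simp))
        ((snd X.toSSet Y.toSSet).app (op ⦋1⦌) e)
    exact this ▸ SSet.σ_mem_degenerate _ _ _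
  · left
    refine ⟨h₁, ?_⟩
    have : SimplicialObject.δ X.toSSet 0 ((fst X.toSSet Y.toSSet).app (op ⦋2⦌)
        ((X.toSSet ⊗ Y.toSSet : SSet.{u}).σ 1 e)) =
        X.toSSet.σ 0 (X.toSSet.δ 0 ((fst X.toSSet Y.toSSet).app (op ⦋1⦌) e)) :=
      ConcreteCategory.congr_hom (X.toSSet.δ_comp_σ_of_le (i := 0) (j := 0) (by simp))
        ((fst X.toSSet Y.toSSet).app (op ⦋1⦌) e)
    exact this ▸ SSet.σ_mem_degenerate _ _ _

/-- The Gray product of scaled simplicial sets. -/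
def gray (X Y : ScaledSSet.{u}) : ScaledSSet.{u} where
  toSSet := X.toSSet ⊗ Y.toSSet
  thin := grayTriangles X Y
  degenerate_le := degenerate_le_grayTriangles X Y

/-- The pairs of thin triangles such that the edge `12` of the first one is invertible in `X`
or the edge `01` of the second one is invertible in `Y`. -/
def invTriangles (X Y : ScaledSSet.{u}) : Set ((X.toSSet ⊗ Y.toSSet : SSet.{u}) _⦋2⦌) :=
  {s | ((fst X.toSSet Y.toSSet).app _ s ∈ X.thin ∧ (snd X.toSSet Y.toSSet).app _ s ∈ Y.thin) ∧
    (X.IsInvertible (X.toSSet.δ 0 ((fst X.toSSet Y.toSSet).app _ s)) ∨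
      Y.IsInvertible (Y.toSSet.δ 2 ((snd X.toSSet Y.toSSet).app _ s)))}

/-- The map from the Gray product to the product of the underlying simplicial sets, with the
scaling `invTriangles`, that is the identity on underlying simplicial sets. -/
def grayToInv (X Y : ScaledSSet.{u}) :
    gray X Y ⟶ ofTriangles (X.toSSet ⊗ Y.toSSet) (invTriangles X Y) where
  hom := 𝟙 _
  map_thin _ hs := Or.inl ⟨hs.1, hs.2.imp (fun h ↦ X.isInvertible_of_degenerate h.2)
    (fun h ↦ Y.isInvertible_of_degenerate h.2)⟩

end ScaledSSet

end

namespace ScaledSSet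

/-! ### The marked simplicial category associated with a scaled simplicial set

The simplicial category `ℭ[X]` is the colimit, over the simplices `Δ[m] ⟶ X`, of the simplicial
thickenings of the linear orders `{0, …, m}`. It is computed in each simplicial degree, where it
is the category with set of objects `X.Vertex` presented by the generators and relations below. -/

/-- Formal composites of morphisms of simplicial thickenings of the simplices of `X`, in
simplicial degree `n`. -/
inductive Word (X : SSet.{u}) (n : SimplexCategoryᵒᵖ) : X.Vertex → X.Vertex → Type u where
  | gen {x y : X.Vertex} {m : ℕ} (s : X.obj (op (.mk m))) (i j : SimplicialThickening (Fin (m + 1)))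
      (g : (nerve (i ⟶ j)).obj n) (hx : SSet.vtx s i.as = x) (hy : SSet.vtx s j.as = y) :
      Word X n x y
  | id (x : X.Vertex) : Word X n x x
  | comp {x y z : X.Vertex} (a : Word X n x y) (b : Word X n y z) : Word X n x z

/-- The map induced on the morphism objects of simplicial thickenings by a map of simplices. -/
abbrev thickeningMap {m m' : ℕ} (φ : SimplexCategory.mk m ⟶ .mk m') (i j : SimplicialThickening (Fin (m + 1))) :
    nerve (i ⟶ j) ⟶ nerve (SimplicialThickening.mk (φ.toOrderHom i.as) ⟶
      SimplicialThickening.mk (φ.toOrderHom j.as)) :=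
  nerveMap (SimplicialThickening.functorMap φ.toOrderHom i j)

/-- The identities in the simplicial thickening, in simplicial degree `n`. -/
abbrev thickeningId {m : ℕ} (n : SimplexCategoryᵒᵖ) (i : SimplicialThickening (Fin (m + 1))) :
    (nerve (i ⟶ i)).obj n :=
  (Functor.const _).obj (𝟙 i)

/-- The composition of the simplicial thickening, in simplicial degree `n`. -/
abbrev thickeningComp {m : ℕ} {n : SimplexCategoryᵒᵖ} {i j k : SimplicialThickening (Fin (m + 1))}
    (g : (nerve (i ⟶ j)).obj n) (h : (nerve (j ⟶ k)).obj n) : (nerve (i ⟶ k)).obj n :=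
  Functor.prod' g h ⋙ SimplicialThickening.compFunctor i j k

/-- The relations of the presentation: the axioms of categories, functoriality of every
simplex of `X` on its simplicial thickening, and compatibility with maps of simplices. -/
inductive WordRel (X : SSet.{u}) (n : SimplexCategoryᵒᵖ) :
    ∀ {x y : X.Vertex}, Word X n x y → Word X n x y → Prop where
  | assoc {x y z w : X.Vertex} (a : Word X n x y) (b : Word X n y z) (c : Word X n z w) :
      WordRel X n ((a.comp b).comp c) (a.comp (b.comp c))
  | id_comp {x y : X.Vertex} (a : Word X n x y) : WordRel X n ((Word.id x).comp a) a
  | comp_id {x y : X.Vertex} (a : Word X n x y) : WordRel X n (a.comp (Word.id y)) a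
  | comp_right {x y z : X.Vertex} (a : Word X n x y) {b b' : Word X n y z}
      (h : WordRel X n b b') : WordRel X n (a.comp b) (a.comp b')
  | comp_left {x y z : X.Vertex} {a a' : Word X n x y} (h : WordRel X n a a')
      (b : Word X n y z) : WordRel X n (a.comp b) (a'.comp b)
  | gen_id {x : X.Vertex} {m : ℕ} (s : X.obj (op (.mk m))) (i : SimplicialThickening (Fin (m + 1)))
      (hx : SSet.vtx s i.as = x) :
      WordRel X n (Word.gen s i i (thickeningId n i) hx hx) (Word.id x)
  | gen_comp {x y z : X.Vertex} {m : ℕ} (s : X.obj (op (.mk m)))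
      (i j k : SimplicialThickening (Fin (m + 1)))
      (g : (nerve (i ⟶ j)).obj n) (h : (nerve (j ⟶ k)).obj n)
      (hx : SSet.vtx s i.as = x) (hy : SSet.vtx s j.as = y) (hz : SSet.vtx s k.as = z) :
      WordRel X n (Word.gen s i k (thickeningComp g h) hx hz)
        ((Word.gen s i j g hx hy).comp (Word.gen s j k h hy hz))
  | gen_map {x y : X.Vertex} {m m' : ℕ} (φ : SimplexCategory.mk m ⟶ .mk m') (s : X.obj (op (.mk m')))
      (i j : SimplicialThickening (Fin (m + 1))) (g : (nerve (i ⟶ j)).obj n)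
      (hx : SSet.vtx (X.map φ.op s) i.as = x) (hy : SSet.vtx (X.map φ.op s) j.as = y)
      (hx' : SSet.vtx s (φ.toOrderHom i.as) = x) (hy' : SSet.vtx s (φ.toOrderHom j.as) = y) :
      WordRel X n (Word.gen (X.map φ.op s) i j g hx hy)
        (Word.gen s (.mk (φ.toOrderHom i.as)) (.mk (φ.toOrderHom j.as))
          ((thickeningMap φ i j).app n g) hx' hy')

/-- The action of a map of simplicial degrees on words. -/
def Word.degreeMap {X : SSet.{u}} {n n' : SimplexCategoryᵒᵖ} (θ : n ⟶ n') :
    ∀ {x y : X.Vertex}, Word X n x y → Word X n' x y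
  | _, _, .gen s i j g hx hy => .gen s i j ((nerve (i ⟶ j)).map θ g) hx hy
  | _, _, .id x => .id x
  | _, _, .comp a b => .comp (a.degreeMap θ) (b.degreeMap θ)

theorem WordRel.degreeMap {X : SSet.{u}} {n n' : SimplexCategoryᵒᵖ} (θ : n ⟶ n')
    {x y : X.Vertex} {a b : Word X n x y} (h : WordRel X n a b) :
    WordRel X n' (a.degreeMap θ) (b.degreeMap θ) := by
  induction h with
  | assoc a b c => exact .assoc _ _ _
  | id_comp a => exact .id_comp _
  | comp_id a => exact .comp_id _
  | comp_right a _ ih => exact .comp_right _ ih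
  | comp_left _ b ih => exact .comp_left ih _
  | gen_id s i hx => exact .gen_id s i hx
  | gen_comp s i j k g h hx hy hz => exact .gen_comp s i j k ((nerve (i ⟶ j)).map θ g) ((nerve (j ⟶ k)).map θ h) hx hy hz
  | gen_map φ s i j g hx hy hx' hy' => exact .gen_map φ s i j _ hx hy hx' hy'

/-- The action of a map of simplicial sets on words. -/
def Word.map {X Y : SSet.{u}} (f : X ⟶ Y) {n : SimplexCategoryᵒᵖ} :
    ∀ {x y : X.Vertex}, Word X n x y → Word Y n (f.app _ x) (f.app _ y)
  | _, _, .gen s i j g hx hy => .gen (f.app _ s) i j g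
      (by rw [SSet.vtx_app, hx]) (by rw [SSet.vtx_app, hy])
  | _, _, .id x => .id _
  | _, _, .comp a b => .comp (a.map f) (b.map f)

theorem WordRel.gen_map' {X : SSet.{u}} {n : SimplexCategoryᵒᵖ} {x y : X.Vertex} {m m' : ℕ}
    (φ : SimplexCategory.mk m ⟶ .mk m') (s : X.obj (op (.mk m'))) (t : X.obj (op (.mk m))) (ht : t = X.map φ.op s)
    (i j : SimplicialThickening (Fin (m + 1))) (g : (nerve (i ⟶ j)).obj n)
    (hx : SSet.vtx t i.as = x) (hy : SSet.vtx t j.as = y)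
    (hx' : SSet.vtx s (φ.toOrderHom i.as) = x) (hy' : SSet.vtx s (φ.toOrderHom j.as) = y) :
    WordRel X n (Word.gen t i j g hx hy)
      (Word.gen s (.mk (φ.toOrderHom i.as)) (.mk (φ.toOrderHom j.as))
        ((thickeningMap φ i j).app n g) hx' hy') := by
  subst ht
  exact .gen_map φ s i j g hx hy hx' hy'

theorem WordRel.map {X Y : SSet.{u}} (f : X ⟶ Y) {n : SimplexCategoryᵒᵖ}
    {x y : X.Vertex} {a b : Word X n x y} (h : WordRel X n a b) :
    WordRel Y n (a.map f) (b.map f) := by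
  induction h with
  | assoc a b c => exact .assoc _ _ _
  | id_comp a => exact .id_comp _
  | comp_id a => exact .comp_id _
  | comp_right a _ ih => exact .comp_right _ ih
  | comp_left _ b ih => exact .comp_left ih _
  | gen_id s i hx => exact .gen_id (f.app _ s) i _
  | gen_comp s i j k g h hx hy hz =>
    exact .gen_comp (f.app _ s) i j k g h _ (by rw [SSet.vtx_app, hy]) _
  | gen_map φ s i j g hx hy hx' hy' =>
    exact WordRel.gen_map' φ (f.app _ s) _ (NatTrans.naturality_apply f φ.op s) i j g _ _ _ _

/-- The simplicial set of morphisms from `x` to `y` in the simplicial category `ℭ[X]`. -/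
def rigidHom (X : SSet.{u}) (x y : X.Vertex) : SSet.{u} where
  obj n := Quot (WordRel X n (x := x) (y := y))
  map θ := ↾Quot.map (Word.degreeMap θ) fun _ _ h ↦ h.degreeMap θ
  map_id n := by
    ext a
    induction a using Quot.ind with | _ a
    change Quot.mk _ (a.degreeMap (𝟙 n)) = Quot.mk _ a
    congr 1
    induction a with
    | gen s i j g hx hy => simp [Word.degreeMap]
    | id x => rfl
    | comp a b iha ihb => simp only [Word.degreeMap, iha, ihb]
  map_comp {n n' n''} θ θ' := by
    ext a
    induction a using Quot.ind with | _ a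
    change Quot.mk _ (a.degreeMap (θ ≫ θ')) = Quot.mk _ ((a.degreeMap θ).degreeMap θ')
    congr 1
    induction a with
    | gen s i j g hx hy => simp [Word.degreeMap]
    | id x => rfl
    | comp a b iha ihb => simp only [Word.degreeMap, iha, ihb]

/-- The identities of `ℭ[X]`. -/
def rigidId (X : SSet.{u}) (n : SimplexCategoryᵒᵖ) (x : X.Vertex) : (rigidHom X x x).obj n :=
  Quot.mk _ (Word.id x)

/-- The composition of `ℭ[X]`. -/
def rigidComp {X : SSet.{u}} {n : SimplexCategoryᵒᵖ} {x y z : X.Vertex}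
    (a : (rigidHom X x y).obj n) (b : (rigidHom X y z).obj n) : (rigidHom X x z).obj n :=
  Quot.map₂ Word.comp (fun a _ _ h ↦ .comp_right a h) (fun _ _ b h ↦ .comp_left h b) a b

/-- The simplicial functor `ℭ[X] ⟶ ℭ[Y]` induced by a map `X ⟶ Y`. -/
def rigidMap {X Y : SSet.{u}} (f : X ⟶ Y) (x y : X.Vertex) :
    rigidHom X x y ⟶ rigidHom Y (f.app _ x) (f.app _ y) where
  app n := ↾Quot.map (Word.map f) fun _ _ h ↦ h.map f
  naturality n n' θ := by
    ext a
    induction a using Quot.ind with | _ a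
    change Quot.mk _ ((a.degreeMap θ).map f) = Quot.mk _ ((a.map f).degreeMap θ)
    congr 1
    induction a with
    | gen s i j g hx hy => rfl
    | id x => rfl
    | comp a b iha ihb => simp only [Word.degreeMap, Word.map, iha, ihb]

/-- The nondegenerate edge from `{0, 2}` to `{0, 1, 2}` of the simplicial set of morphisms from
`0` to `2` in the simplicial thickening of `{0, 1, 2}`. -/
def thickeningEdge :
    (nerve (SimplicialThickening.mk (0 : Fin 3) ⟶ SimplicialThickening.mk (2 : Fin 3))).obj
      (op (.mk 1)) :=
  ComposableArrows.mk₁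
    (X₀ := (({ I := {0, 2}
               left_le := fun _ _ ↦ Fin.zero_le _
               le_right := fun k _ ↦ Fin.le_last k } :
        SimplicialThickening.Path (0 : Fin 3) 2)))
    (X₁ := (({ I := Set.univ
               left_le := fun _ _ ↦ Fin.zero_le _
               le_right := fun k _ ↦ Fin.le_last k } :
        SimplicialThickening.Path (0 : Fin 3) 2)))
    ⟨⟨⟨Set.subset_univ _⟩⟩⟩

/-- The edge of a morphism object of `ℭ[X]` given by a triangle of `X`. -/
def triangleEdge {X : SSet.{u}} (s : X.obj (op (.mk 2))) : (rigidHom X (SSet.vtx s 0) (SSet.vtx s 2)).obj (op (.mk 1)) :=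
  Quot.mk _ (.gen s (.mk 0) (.mk 2) thickeningEdge rfl rfl)

/-- The marked edges of the morphism objects of `ℭ[X]`: the smallest family that contains the
degenerate edges and the edges given by thin triangles, and is closed under composition. -/
inductive IsRigidMarked (X : ScaledSSet.{u}) :
    ∀ {x y : X.toSSet.Vertex}, (rigidHom X.toSSet x y).obj (op (.mk 1)) → Prop where
  | degenerate {x y : X.toSSet.Vertex} (e : (rigidHom X.toSSet x y).obj (op (.mk 1)))
      (he : e ∈ (rigidHom X.toSSet x y).degenerate 1) : IsRigidMarked X e
  | thin (s : X.toSSet.obj (op (.mk 2))) (hs : s ∈ X.thin) : IsRigidMarked X (triangleEdge s)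
  | comp {x y z : X.toSSet.Vertex} {a : (rigidHom X.toSSet x y).obj (op (.mk 1))}
      {b : (rigidHom X.toSSet y z).obj (op (.mk 1))} (ha : IsRigidMarked X a) (hb : IsRigidMarked X b) :
      IsRigidMarked X (rigidComp a b)

theorem IsRigidMarked.map {X Y : ScaledSSet.{u}} (f : X ⟶ Y) {x y : X.toSSet.Vertex}
    {e : (rigidHom X.toSSet x y).obj (op (.mk 1))} (he : IsRigidMarked X e) :
    IsRigidMarked Y ((rigidMap f.hom x y).app _ e) := by
  induction he with
  | degenerate e he => exact .degenerate _ (SSet.app_mem_degenerate _ he)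
  | thin s hs =>
    have h := IsRigidMarked.thin (X := Y) _ (f.map_thin s hs)
    have key : ∀ (x y : Y.toSSet.Vertex) (hx : SSet.vtx (f.hom.app _ s) 0 = x)
        (hy : SSet.vtx (f.hom.app _ s) 2 = y),
        IsRigidMarked Y (x := x) (y := y)
          (Quot.mk _ (.gen (f.hom.app _ s) (.mk 0) (.mk 2) thickeningEdge hx hy)) := by
      rintro _ _ rfl rfl
      exact h
    exact key _ _ _ _
  | @comp x y z a b ha hb iha ihb =>
    have h := IsRigidMarked.comp iha ihb
    induction a using Quot.ind with | _ a
    induction b using Quot.ind with | _ b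
    exact h

/-- The marked simplicial set of morphisms from `x` to `y` in the marked simplicial category
associated with `X`. -/
def mor (X : ScaledSSet.{u}) (x y : X.toSSet.Vertex) : MarkedSSet.{u} where
  toSSet := rigidHom X.toSSet x y
  marked := {e | IsRigidMarked X e}
  degenerate_le e he := .degenerate e he

/-- The map of morphism objects induced by a map of scaled simplicial sets. -/
def morMap {X Y : ScaledSSet.{u}} (f : X ⟶ Y) (x y : X.toSSet.Vertex) :
    X.mor x y ⟶ Y.mor (f.hom.app _ x) (f.hom.app _ y) where
  hom := rigidMap f.hom x y
  map_marked _ he := he.map f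

/-- Two objects of the marked simplicial category associated with `X` are equivalent if they are
isomorphic in its homotopy category, whose morphisms `x ⟶ y` are the homotopy classes of maps from
the point to the morphism object (each of which is represented by a vertex). -/
def EquivalentObjects (X : ScaledSSet.{u}) (x y : X.toSSet.Vertex) : Prop :=
  ∃ (a : (rigidHom X.toSSet x y).obj (op (.mk 0))) (b : (rigidHom X.toSSet y x).obj (op (.mk 0))),
    MarkedSSet.HomotopicVertices (X := X.mor x x) (rigidComp a b) (rigidId X.toSSet (op (.mk 0)) x) ∧
    MarkedSSet.HomotopicVertices (X := X.mor y y) (rigidComp b a) (rigidId X.toSSet (op (.mk 0)) y)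

/-- A map of scaled simplicial sets is a bicategorical equivalence (a weak equivalence of the
bicategorical model structure) if the induced functor of marked simplicial categories is an
equivalence: it induces marked categorical equivalences on morphism objects and is essentially
surjective on homotopy categories. -/
structure IsBicategoricalEquivalence {X Y : ScaledSSet.{u}} (f : X ⟶ Y) : Prop where
  markedEquivalence : ∀ x y : X.toSSet.Vertex, MarkedSSet.markedEquivalences (morMap f x y)
  essSurj : ∀ y : Y.toSSet.Vertex, ∃ x : X.toSSet.Vertex, Y.EquivalentObjects (f.hom.app _ x) y

end ScaledSSet

open Simplicial

/-! ### Changing the marking of a fixed simplicial set -/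

namespace SSet

/-! Both sides have the same underlying simplicial set, so their marked simplicial categories have
the same objects and simplicial mapping objects and differ only in the markings. By
`markedEquivalences_of_inverse` it is enough that a map `F` from a mapping object to a
quasi-category that inverts all edges marked by the Gray product also inverts those marked by
`invTriangles`. Since `F` is defined on one mapping object only, an edge of another mapping object
is tested through all its whiskerings into that one (`stableEdges`). This makes stability compatible
with composition, and each triangle of the product is then either stable or not.

A tetrahedron gives a commutative square in a mapping object: the triangle 013 followed by 01·123
equals 023 followed by 012·23 (`exists_diagonal_of_tetrahedron`). Two-out-of-three in the homotopy
category of the target thus relates the stability of its faces. Tetrahedra whose other faces are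
Gray thin reduce a pair of thin triangles to the noncommuting triangle of a square `g × r`, with `g`
or `r` invertible (`squareTriangle`).

Let `g` be invertible with inverse `g'`. Pasting the squares of `g` and `g'` along `r` gives the
square of a degenerate edge, whose triangle is Gray thin. So the square of `g`, whiskered by `g'` on
the right, is a split epimorphism; exchanging `g` and `g'`, it is a split monomorphism when
whiskered by `g'` on the left. Whiskering by `g'` can be cancelled, as it is undone by `g` up to a
stable triangle, so the square of `g` is an isomorphism. The argument for `r` is the same with the
two factors exchanged.

That an invertible edge has an actual inverse edge with thin triangles comes from the core: inner
horns of dimensions 2 and 3 have fillers in it, the missing face of a tetrahedron being thin by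
saturation. -/

theorem JHomotopic.refl {X Y : SSet.{u}} (f : X ⟶ Y) : JHomotopic f f :=
  ⟨fst _ _ ≫ f, by simp [cylinderIncl], by simp [cylinderIncl]⟩

theorem isJHomotopyEquivalence_of_comp_eq_id {X Y : SSet.{u}} {f : X ⟶ Y} (g : Y ⟶ X)
    (hfg : f ≫ g = 𝟙 X) (hgf : g ≫ f = 𝟙 Y) : IsJHomotopyEquivalence f :=
  ⟨g, hfg ▸ .refl _, hgf ▸ .refl _⟩

theorem exists_of_mem_degenerate_one {X : SSet.{u}} {e : X _⦋1⦌} (he : e ∈ X.degenerate 1) :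
    ∃ x, X.σ 0 x = e := by
  rw [degenerate_eq_iUnion_range_σ] at he
  simp only [Set.mem_iUnion, Set.mem_range] at he
  obtain ⟨i, x, rfl⟩ := he
  obtain rfl : i = 0 := Fin.fin_one_eq_zero i
  exact ⟨x, rfl⟩

theorem const_app_one_apply {X Y : SSet.{u}} (y : Y _⦋0⦌) (x : X _⦋1⦌) :
    (SSet.const y : X ⟶ Y).app (op ⦋1⦌) x = Y.σ 0 y := by
  change Y.map _ y = Y.map _ y
  congr 3
  exact Subsingleton.elim _ _

theorem id_tensorHom_comp_eq (K : SSet.{u}) {A B W : SSet.{u}} {a : A ⟶ B} {b : B ⟶ A}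
    (h : a ≫ b = 𝟙 A) (φ : K ⊗ A ⟶ W) : (𝟙 K ⊗ₘ a) ≫ (𝟙 K ⊗ₘ b) ≫ φ = φ := by
  rw [tensorHom_comp_tensorHom_assoc, h]
  simp

end SSet

namespace MarkedSSet

/-- A map of marked simplicial sets that is an isomorphism on underlying simplicial sets is a
marked categorical equivalence as soon as every map to a quasi-category that sends the marked
edges of the source to equivalences does so with the marked edges of the target. -/
theorem markedEquivalences_of_inverse {X Y : MarkedSSet.{u}} (f : X ⟶ Y)
    (g : Y.toSSet ⟶ X.toSSet) (hfg : f.hom ≫ g = 𝟙 _) (hgf : g ≫ f.hom = 𝟙 _)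
    (h : ∀ (Z : SSet.{u}) (φ : X.toSSet ⟶ Z),
      (∀ e ∈ X.marked, SSet.IsEquivalenceEdge (φ.app _ e)) →
        ∀ e ∈ Y.marked, SSet.IsEquivalenceEdge (φ.app _ (g.app _ e))) :
    markedEquivalences f := by
  intro Z _
  refine SSet.isJHomotopyEquivalence_of_comp_eq_id
    (g := { app := fun n ↦ ↾fun φ ↦
              { hom := (𝟙 (SSet.stdSimplex.obj n.unop) ⊗ₘ g) ≫ φ.hom
                map_marked := ?_ }
            naturality := ?_ }) ?_ ?_
  -- The simplex factor is marked flatly, so the first component of a marked edge is degenerate on a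
  -- vertex `x`; the edge lies in the slice over `x`, and `h` applies to the restriction of `φ` to
  -- that slice.
  · rintro ⟨e₁, e₂⟩ ⟨h₁, h₂⟩
    obtain ⟨x, rfl⟩ := SSet.exists_of_mem_degenerate_one h₁
    have hx {K : SSet.{u}} (y : K _⦋1⦌) := SSet.const_app_one_apply x y
    have key := h Z (lift (SSet.const x) (𝟙 _) ≫ φ.hom) (fun e he ↦ ?_) e₂ h₂
    · refine Eq.mp ?_ key
      change SSet.IsEquivalenceEdge (φ.hom.app _ (((SSet.const x : X.toSSet ⟶ _).app (op ⦋1⦌)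
        (g.app _ e₂), g.app _ e₂) : _ × _)) = _
      rw [hx]
      rfl
    · refine φ.map_marked (((SSet.const x : X.toSSet ⟶ _).app (op ⦋1⦌) e, e) : _ × _) ⟨?_, he⟩
      rw [hx]
      exact h₁
  · intro n n' θ
    apply ConcreteCategory.hom_ext
    intro φ
    apply hom_ext
    rfl
  · ext n φ
    exact hom_ext (SSet.id_tensorHom_comp_eq _ hgf φ.hom)
  · ext n φ
    exact hom_ext (SSet.id_tensorHom_comp_eq _ hfg φ.hom)

end MarkedSSet

/-! ### Classes of edges defined in the homotopy category -/

namespace SSet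

/-- The edges of a simplicial set whose class in the homotopy category satisfies `Q`. -/
def edgesOf {Z : SSet.{u}}
    (Q : MorphismProperty ((truncation 2).obj Z).HomotopyCategory) : Set (Z _⦋1⦌) :=
  {e | Q (Truncated.HomotopyCategory.homMk (Edge.mk' e).toTruncated)}

theorem edge_mem_edgesOf_iff {Z : SSet.{u}}
    (Q : MorphismProperty ((truncation 2).obj Z).HomotopyCategory)
    {x y : ((truncation 2).obj Z).obj (op ⟨⦋0⦌, by simp⟩)} (e : Truncated.Edge x y) :
    (Edge.ofTruncated e).edge ∈ edgesOf Q ↔ Q (Truncated.HomotopyCategory.homMk e) := by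
  obtain ⟨e, rfl, rfl⟩ := e
  rfl

/-- The morphisms are chosen before `Q`, so that isomorphisms, split monomorphisms and split
epimorphisms can be compared on the same factorization. -/
theorem exists_factorization_of_triangle {Z : SSet.{u}} (s : Z _⦋2⦌) :
    ∃ (x y z : ((truncation 2).obj Z).HomotopyCategory) (f : x ⟶ y) (g : y ⟶ z),
      ∀ Q : MorphismProperty ((truncation 2).obj Z).HomotopyCategory,
        (Z.δ 2 s ∈ edgesOf Q ↔ Q f) ∧ (Z.δ 0 s ∈ edgesOf Q ↔ Q g) ∧
          (Z.δ 1 s ∈ edgesOf Q ↔ Q (f ≫ g)) := by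
  obtain ⟨x, y, z, e, e', e'', h, rfl⟩ := Edge.CompStruct.exists_of_simplex s
  refine ⟨_, _, _, Truncated.HomotopyCategory.homMk e.toTruncated,
    Truncated.HomotopyCategory.homMk e'.toTruncated, fun Q ↦ ?_⟩
  rw [Truncated.HomotopyCategory.homMk_comp_homMk h.toTruncated, h.d₀, h.d₁, h.d₂]
  exact ⟨edge_mem_edgesOf_iff Q e.toTruncated, edge_mem_edgesOf_iff Q e'.toTruncated,
    edge_mem_edgesOf_iff Q e''.toTruncated⟩

end SSet

/-! ### Split monomorphisms and split epimorphisms as morphism properties -/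

/-- The split monomorphisms of a category. -/
def CategoryTheory.MorphismProperty.splitMonos (C : Type*) [Category C] : MorphismProperty C :=
  fun _ _ f ↦ IsSplitMono f

/-- The split epimorphisms of a category. -/
def CategoryTheory.MorphismProperty.splitEpis (C : Type*) [Category C] : MorphismProperty C :=
  fun _ _ f ↦ IsSplitEpi f

namespace CategoryTheory.MorphismProperty

variable (C : Type*) [Category C]

instance : (splitMonos C).RespectsIso where
  precomp e (_ : IsIso e) f (_ : IsSplitMono f) := by
    change IsSplitMono (e ≫ f)
    infer_instance
  postcomp e (_ : IsIso e) f (_ : IsSplitMono f) := by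
    change IsSplitMono (f ≫ e)
    infer_instance

instance : (splitEpis C).RespectsIso where
  precomp e (_ : IsIso e) f (_ : IsSplitEpi f) := by
    change IsSplitEpi (e ≫ f)
    infer_instance
  postcomp e (_ : IsIso e) f (_ : IsSplitEpi f) := by
    change IsSplitEpi (f ≫ e)
    infer_instance

variable {C}

theorem splitMonos_of_comp {X Y Z : C} {f : X ⟶ Y} {g : Y ⟶ Z} (h : splitMonos C (f ≫ g)) :
    splitMonos C f := by
  obtain ⟨⟨r, hr⟩⟩ := h
  exact ⟨⟨g ≫ r, by rw [← hr, Category.assoc]⟩⟩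

theorem splitEpis_of_comp {X Y Z : C} {f : X ⟶ Y} {g : Y ⟶ Z} (h : splitEpis C (f ≫ g)) :
    splitEpis C g := by
  obtain ⟨⟨r, hr⟩⟩ := h
  exact ⟨⟨r ≫ f, by rw [Category.assoc, hr]⟩⟩

theorem isomorphisms_of_splitMonos_of_splitEpis {X Y : C} {f : X ⟶ Y} (h : splitMonos C f)
    (h' : splitEpis C f) : isomorphisms C f := by
  have : IsSplitMono f := h
  have : IsSplitEpi f := h'
  exact isIso_of_mono_of_isSplitEpi f

end CategoryTheory.MorphismProperty

/-! ### Composition and whiskering in the simplicial category of `X` -/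

namespace ScaledSSet

section

variable {X : SSet.{u}} {n n' : SimplexCategoryᵒᵖ} {x y z w : X.Vertex}

theorem rigidComp_assoc (a : (rigidHom X x y).obj n) (b : (rigidHom X y z).obj n)
    (c : (rigidHom X z w).obj n) :
    rigidComp (rigidComp a b) c = rigidComp a (rigidComp b c) := by
  induction a using Quot.ind with | _ a
  induction b using Quot.ind with | _ b
  induction c using Quot.ind with | _ c
  exact Quot.sound (.assoc a b c)

theorem rigidId_comp (a : (rigidHom X x y).obj n) : rigidComp (rigidId X n x) a = a := by
  induction a using Quot.ind with | _ a
  exact Quot.sound (.id_comp a)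

theorem comp_rigidId (a : (rigidHom X x y).obj n) : rigidComp a (rigidId X n y) = a := by
  induction a using Quot.ind with | _ a
  exact Quot.sound (.comp_id a)

theorem map_rigidComp (θ : n ⟶ n') (a : (rigidHom X x y).obj n) (b : (rigidHom X y z).obj n) :
    (rigidHom X x z).map θ (rigidComp a b) =
      rigidComp ((rigidHom X x y).map θ a) ((rigidHom X y z).map θ b) := by
  induction a using Quot.ind with | _ a
  induction b using Quot.ind with | _ b
  rfl

theorem rigidMap_id (X : SSet.{u}) (x y : X.Vertex) : rigidMap (𝟙 X) x y = 𝟙 _ := by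
  ext n a
  induction a using Quot.ind with | _ a
  change Quot.mk _ (a.map (𝟙 X)) = Quot.mk _ a
  congr 1
  induction a with
  | gen s i j g hx hy => rfl
  | id x => rfl
  | comp a b iha ihb =>
    simp only [Word.map, iha, ihb]
    rfl

end

/-- The totally degenerate simplex on a vertex. -/
abbrev constSimplex {K : SSet.{u}} (v : K _⦋0⦌) (n : SimplexCategoryᵒᵖ) : K.obj n :=
  K.map (SimplexCategory.const n.unop ⦋0⦌ 0).op v

theorem map_constSimplex {K : SSet.{u}} (v : K _⦋0⦌) {n n' : SimplexCategoryᵒᵖ} (θ : n ⟶ n') :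
    K.map θ (constSimplex v n) = constSimplex v n' := by
  rw [constSimplex, ← Functor.map_comp_apply]
  congr 3

theorem constSimplex_zero {K : SSet.{u}} (v : K _⦋0⦌) : constSimplex v (op ⦋0⦌) = v := by
  have : SimplexCategory.const ⦋0⦌ ⦋0⦌ 0 = 𝟙 _ := Subsingleton.elim _ _
  simp [constSimplex, this]

theorem constSimplex_mem_degenerate {K : SSet.{u}} (v : K _⦋0⦌) :
    constSimplex v (op ⦋1⦌) ∈ K.degenerate 1 :=
  ⟨0, by simp, _, v, rfl⟩

/-- Whiskering of simplices of morphism objects by vertices. -/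
def whisker {X : SSet.{u}} {n : SimplexCategoryᵒᵖ} {x a b y : X.Vertex}
    (l : (rigidHom X x a).obj (op ⦋0⦌)) (e : (rigidHom X a b).obj n)
    (r : (rigidHom X b y).obj (op ⦋0⦌)) : (rigidHom X x y).obj n :=
  rigidComp (rigidComp (constSimplex l n) e) (constSimplex r n)

section

variable {X : SSet.{u}} {n n' : SimplexCategoryᵒᵖ} {x a b c y : X.Vertex}

theorem map_whisker (θ : n ⟶ n') (l : (rigidHom X x a).obj (op ⦋0⦌))
    (e : (rigidHom X a b).obj n) (r : (rigidHom X b y).obj (op ⦋0⦌)) :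
    (rigidHom X x y).map θ (whisker l e r) = whisker l ((rigidHom X a b).map θ e) r := by
  simp only [whisker, map_rigidComp, map_constSimplex]

theorem constSimplex_rigidComp (l : (rigidHom X a b).obj (op ⦋0⦌))
    (r : (rigidHom X b c).obj (op ⦋0⦌)) (n : SimplexCategoryᵒᵖ) :
    constSimplex (rigidComp l r) n = rigidComp (constSimplex l n) (constSimplex r n) :=
  map_rigidComp _ l r

theorem constSimplex_rigidId (n : SimplexCategoryᵒᵖ) (x : X.Vertex) :
    constSimplex (K := rigidHom X x x) (rigidId X (op ⦋0⦌) x) n = rigidId X n x := rfl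

theorem whisker_constSimplex_comp (l : (rigidHom X x a).obj (op ⦋0⦌))
    (v : (rigidHom X a b).obj (op ⦋0⦌)) (e : (rigidHom X b c).obj n)
    (r : (rigidHom X c y).obj (op ⦋0⦌)) :
    whisker l (rigidComp (constSimplex v n) e) r = whisker (rigidComp l v) e r := by
  simp only [whisker, constSimplex_rigidComp, rigidComp_assoc]

theorem whisker_comp_constSimplex (l : (rigidHom X x a).obj (op ⦋0⦌))
    (e : (rigidHom X a b).obj n) (v : (rigidHom X b c).obj (op ⦋0⦌))
    (r : (rigidHom X c y).obj (op ⦋0⦌)) :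
    whisker l (rigidComp e (constSimplex v n)) r = whisker l e (rigidComp v r) := by
  simp only [whisker, constSimplex_rigidComp, rigidComp_assoc]

theorem whisker_id_id (e : (rigidHom X a b).obj n) :
    whisker (rigidId X _ a) e (rigidId X _ b) = e := by
  simp only [whisker, constSimplex_rigidId, rigidId_comp, comp_rigidId]

end

/-! ### Stable edges and two-out-of-three -/

open MorphismProperty

variable {X : SSet.{u}} {x y : X.Vertex} {Z : SSet.{u}} (F : rigidHom X x y ⟶ Z)

/-- The edges of the morphism objects of `ℭ[X]` all of whose whiskerings are sent by `F` to edges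
whose class in the homotopy category of `Z` satisfies `Q`. -/
def stableEdges (Q : MorphismProperty ((SSet.truncation 2).obj Z).HomotopyCategory)
    {a b : X.Vertex} : Set ((rigidHom X a b) _⦋1⦌) :=
  {e | ∀ l r, F.app _ (whisker l e r) ∈ SSet.edgesOf Q}

variable {Q : MorphismProperty ((SSet.truncation 2).obj Z).HomotopyCategory} {F}
  {a b c : X.Vertex}

/-- Whiskering commutes with faces, so a triangle of any mapping object becomes, for each `l` and
`r`, a commutative triangle in the homotopy category of `Z`. -/
theorem exists_factorization_of_whisker (s : (rigidHom X a b) _⦋2⦌) (l r) :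
    ∃ (x y z : ((SSet.truncation 2).obj Z).HomotopyCategory) (f : x ⟶ y) (g : y ⟶ z),
      ∀ Q : MorphismProperty ((SSet.truncation 2).obj Z).HomotopyCategory,
        (F.app _ (whisker l ((rigidHom X a b).δ 2 s) r) ∈ SSet.edgesOf Q ↔ Q f) ∧
        (F.app _ (whisker l ((rigidHom X a b).δ 0 s) r) ∈ SSet.edgesOf Q ↔ Q g) ∧
        (F.app _ (whisker l ((rigidHom X a b).δ 1 s) r) ∈ SSet.edgesOf Q ↔ Q (f ≫ g)) := by
  have key (i : Fin 3) : Z.δ i (F.app _ (whisker l s r)) =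
      F.app _ (whisker l ((rigidHom X a b).δ i s) r) := by
    have := NatTrans.naturality_apply F (SimplexCategory.δ i).op (whisker l s r)
    rw [map_whisker] at this
    exact this.symm
  obtain ⟨x, y, z, f, g, h⟩ := SSet.exists_factorization_of_triangle (F.app _ (whisker l s r))
  simp only [key] at h
  exact ⟨x, y, z, f, g, h⟩

/-- Composing with an isomorphism does not affect a property that respects isomorphisms. Keeping `Q`
general serves split monomorphisms and split epimorphisms as well. -/
theorem stableEdges_δ₀_iff [Q.RespectsIso] {s : (rigidHom X a b) _⦋2⦌}
    {e₀₁ e₁₂ e₀₂ : (rigidHom X a b) _⦋1⦌} (h₂ : (rigidHom X a b).δ 2 s = e₀₁)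
    (h₀ : (rigidHom X a b).δ 0 s = e₁₂) (h₁ : (rigidHom X a b).δ 1 s = e₀₂)
    (h : e₀₁ ∈ stableEdges F (isomorphisms _)) :
    e₁₂ ∈ stableEdges F Q ↔ e₀₂ ∈ stableEdges F Q := by
  subst h₀ h₁ h₂
  refine forall₂_congr fun l r ↦ ?_
  obtain ⟨x, y, z, f, g, h'⟩ := exists_factorization_of_whisker (F := F) s l r
  have hf : IsIso f := (h' _).1.1 (h l r)
  rw [(h' Q).2.1, (h' Q).2.2, Q.cancel_left_of_respectsIso]

theorem stableEdges_δ₂_iff [Q.RespectsIso] {s : (rigidHom X a b) _⦋2⦌}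
    {e₀₁ e₁₂ e₀₂ : (rigidHom X a b) _⦋1⦌} (h₂ : (rigidHom X a b).δ 2 s = e₀₁)
    (h₀ : (rigidHom X a b).δ 0 s = e₁₂) (h₁ : (rigidHom X a b).δ 1 s = e₀₂)
    (h : e₁₂ ∈ stableEdges F (isomorphisms _)) :
    e₀₁ ∈ stableEdges F Q ↔ e₀₂ ∈ stableEdges F Q := by
  subst h₀ h₁ h₂
  refine forall₂_congr fun l r ↦ ?_
  obtain ⟨x, y, z, f, g, h'⟩ := exists_factorization_of_whisker (F := F) s l r
  have hf : IsIso g := (h' _).2.1.1 (h l r)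
  rw [(h' Q).1, (h' Q).2.2, Q.cancel_right_of_respectsIso]

theorem stableEdges_splitMonos_δ₂ {s : (rigidHom X a b) _⦋2⦌}
    {e₀₁ e₀₂ : (rigidHom X a b) _⦋1⦌} (h₂ : (rigidHom X a b).δ 2 s = e₀₁)
    (h₁ : (rigidHom X a b).δ 1 s = e₀₂)
    (h : e₀₂ ∈ stableEdges F (splitMonos _)) : e₀₁ ∈ stableEdges F (splitMonos _) := by
  subst h₁ h₂
  intro l r
  obtain ⟨x, y, z, f, g, h'⟩ := exists_factorization_of_whisker (F := F) s l r
  exact (h' _).1.2 (splitMonos_of_comp ((h' _).2.2.1 (h l r)))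

theorem stableEdges_splitEpis_δ₀ {s : (rigidHom X a b) _⦋2⦌}
    {e₁₂ e₀₂ : (rigidHom X a b) _⦋1⦌} (h₀ : (rigidHom X a b).δ 0 s = e₁₂)
    (h₁ : (rigidHom X a b).δ 1 s = e₀₂)
    (h : e₀₂ ∈ stableEdges F (splitEpis _)) : e₁₂ ∈ stableEdges F (splitEpis _) := by
  subst h₁ h₀
  intro l r
  obtain ⟨x, y, z, f, g, h'⟩ := exists_factorization_of_whisker (F := F) s l r
  exact (h' _).2.1.2 (splitEpis_of_comp ((h' _).2.2.1 (h l r)))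

theorem stableEdges_isomorphisms_iff {e : (rigidHom X a b) _⦋1⦌} :
    e ∈ stableEdges F (isomorphisms _) ↔
      e ∈ stableEdges F (splitMonos _) ∧ e ∈ stableEdges F (splitEpis _) := by
  refine ⟨fun h ↦ ⟨fun l r ↦ ?_, fun l r ↦ ?_⟩, fun h l r ↦
    isomorphisms_of_splitMonos_of_splitEpis (h.1 l r) (h.2 l r)⟩
  · have : IsIso _ := h l r
    exact IsSplitMono.of_iso _
  · have : IsIso _ := h l r
    exact IsSplitEpi.of_iso _

/-- A whiskering of a whiskering is a whiskering; this is what quantifying over all `l` and `r`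
provides. -/
theorem constSimplex_comp_mem_stableEdges {e : (rigidHom X b c) _⦋1⦌} (h : e ∈ stableEdges F Q)
    (v : (rigidHom X a b) _⦋0⦌) : rigidComp (constSimplex v _) e ∈ stableEdges F Q :=
  fun l r ↦ whisker_constSimplex_comp l v e r ▸ h _ _

theorem comp_constSimplex_mem_stableEdges {e : (rigidHom X a b) _⦋1⦌} (h : e ∈ stableEdges F Q)
    (v : (rigidHom X b c) _⦋0⦌) : rigidComp e (constSimplex v _) ∈ stableEdges F Q :=
  fun l r ↦ whisker_comp_constSimplex l e v r ▸ h _ _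

theorem mem_stableEdges_of_degenerate {e : (rigidHom X a b) _⦋1⦌}
    (h : e ∈ (rigidHom X a b).degenerate 1) : e ∈ stableEdges F (isomorphisms _) := by
  intro l r
  obtain ⟨v, rfl⟩ := SSet.exists_of_mem_degenerate_one h
  refine SSet.isEquivalenceEdge_of_degenerate (SSet.app_mem_degenerate _ ?_)
  have := map_whisker (SimplexCategory.σ (0 : Fin 1)).op l v r
  change whisker l ((rigidHom X a b).map _ v) r ∈ _
  rw [← this]
  exact SSet.σ_mem_degenerate _ _ _

/-! ### Horizontal composites of edges of morphism objects -/

theorem δ_map_σ {K : SSet.{u}} {θ : ⦋1⦌ ⟶ ⦋2⦌} {σ : ⦋2⦌ ⟶ ⦋1⦌} {τ : ⦋1⦌ ⟶ ⦋1⦌}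
    (h : θ ≫ σ = τ) (e : K _⦋1⦌) : K.map θ.op (K.map σ.op e) = K.map τ.op e := by
  rw [← h, op_comp, Functor.map_comp_apply]

variable (e : (rigidHom X a b) _⦋1⦌) (e' : (rigidHom X b c) _⦋1⦌)

/-- The `2`-simplex with edges `src e ≫ e'`, `e ≫ tgt e'` and `e ≫ e'`. -/
def interchangeσ₀ : (rigidHom X a c) _⦋2⦌ :=
  rigidComp ((rigidHom X a b).σ 0 e) ((rigidHom X b c).σ 1 e')

/-- The `2`-simplex with edges `e ≫ src e'`, `tgt e ≫ e'` and `e ≫ e'`. -/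
def interchangeσ₁ : (rigidHom X a c) _⦋2⦌ :=
  rigidComp ((rigidHom X a b).σ 1 e) ((rigidHom X b c).σ 0 e')

theorem map_eq_constSimplex {K : SSet.{u}} (e : K _⦋1⦌) {θ : ⦋1⦌ ⟶ ⦋1⦌} (j : Fin 2)
    (h : θ = SimplexCategory.σ 0 ≫ SimplexCategory.δ j) :
    K.map θ.op e = constSimplex (K.δ j e) (op ⦋1⦌) := by
  rw [h, op_comp, Functor.map_comp_apply]
  change K.map _ _ = K.map _ _
  congr 3
  exact Subsingleton.elim _ _

/-- The composition map sends the square `e × e'` to the mapping object from `a` to `c`; this is one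
of the two triangles into which its diagonal `e ≫ e'` cuts it, and `interchangeσ₁` is the other. -/
theorem δ_interchangeσ₀ :
    (rigidHom X a c).δ 2 (interchangeσ₀ e e') =
        rigidComp (constSimplex ((rigidHom X a b).δ 1 e) _) e' ∧
      (rigidHom X a c).δ 0 (interchangeσ₀ e e') =
        rigidComp e (constSimplex ((rigidHom X b c).δ 0 e') _) ∧
      (rigidHom X a c).δ 1 (interchangeσ₀ e e') = rigidComp e e' := by
  refine ⟨(map_rigidComp _ _ _).trans ?_, (map_rigidComp _ _ _).trans ?_,
    (map_rigidComp _ _ _).trans ?_⟩ <;> congr 1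
  · rw [← map_eq_constSimplex e (θ := SimplexCategory.δ 2 ≫ SimplexCategory.σ 0) 1 (by decide)]
    exact δ_map_σ rfl _
  · exact (δ_map_σ (τ := 𝟙 _) (by decide) _).trans (by simp)
  · exact (δ_map_σ (τ := 𝟙 _) (by decide) _).trans (by simp)
  · rw [← map_eq_constSimplex e' (θ := SimplexCategory.δ 0 ≫ SimplexCategory.σ 1) 0 (by decide)]
    exact δ_map_σ rfl _
  · exact (δ_map_σ (τ := 𝟙 _) (by decide) _).trans (by simp)
  · exact (δ_map_σ (τ := 𝟙 _) (by decide) _).trans (by simp)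

theorem δ_interchangeσ₁ :
    (rigidHom X a c).δ 2 (interchangeσ₁ e e') =
        rigidComp e (constSimplex ((rigidHom X b c).δ 1 e') _) ∧
      (rigidHom X a c).δ 0 (interchangeσ₁ e e') =
        rigidComp (constSimplex ((rigidHom X a b).δ 0 e) _) e' ∧
      (rigidHom X a c).δ 1 (interchangeσ₁ e e') = rigidComp e e' := by
  refine ⟨(map_rigidComp _ _ _).trans ?_, (map_rigidComp _ _ _).trans ?_,
    (map_rigidComp _ _ _).trans ?_⟩ <;> congr 1
  · exact (δ_map_σ (τ := 𝟙 _) (by decide) _).trans (by simp)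
  · rw [← map_eq_constSimplex e' (θ := SimplexCategory.δ 2 ≫ SimplexCategory.σ 0) 1 (by decide)]
    exact δ_map_σ rfl _
  · rw [← map_eq_constSimplex e (θ := SimplexCategory.δ 0 ≫ SimplexCategory.σ 1) 0 (by decide)]
    exact δ_map_σ rfl _
  · exact (δ_map_σ (τ := 𝟙 _) (by decide) _).trans (by simp)
  · exact (δ_map_σ (τ := 𝟙 _) (by decide) _).trans (by simp)
  · exact (δ_map_σ (τ := 𝟙 _) (by decide) _).trans (by simp)

variable {e e'}

/-- By interchange, a horizontal composite is a vertical composite of two whiskered edges. -/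
theorem rigidComp_mem_stableEdges (h : e ∈ stableEdges F (isomorphisms _))
    (h' : e' ∈ stableEdges F (isomorphisms _)) :
    rigidComp e e' ∈ stableEdges F (isomorphisms _) := by
  obtain ⟨h₂, h₀, h₁⟩ := δ_interchangeσ₀ e e'
  exact (stableEdges_δ₀_iff h₂ h₀ h₁ (constSimplex_comp_mem_stableEdges h' _)).1
    (comp_constSimplex_mem_stableEdges h _)

/-- If `t` is an edge from the identity of `b` to `v` that belongs to the stable class of
isomorphisms, then `e` belongs to a stable class if and only if `e ≫ v` does. -/
theorem comp_constSimplex_mem_stableEdges_iff [Q.RespectsIso] {t : (rigidHom X b b) _⦋1⦌}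
    (ht : t ∈ stableEdges F (isomorphisms _))
    (hs : (rigidHom X b b).δ 1 t = rigidId X (op ⦋0⦌) b) :
    rigidComp e (constSimplex ((rigidHom X b b).δ 0 t) _) ∈ stableEdges F Q ↔
      e ∈ stableEdges F Q := by
  obtain ⟨h₂, h₀, h₁⟩ := δ_interchangeσ₀ e t
  obtain ⟨h₂', h₀', h₁'⟩ := δ_interchangeσ₁ e t
  -- Both triangles of the square `e × t` have a whiskering of `t` as one leg; passing through the
  -- common diagonal `e ≫ t` compares `e ≫ v` with `e ≫ id`.
  rw [stableEdges_δ₀_iff h₂ h₀ h₁ (constSimplex_comp_mem_stableEdges ht _),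
    ← stableEdges_δ₂_iff h₂' h₀' h₁' (constSimplex_comp_mem_stableEdges ht _), hs,
    constSimplex_rigidId, comp_rigidId]

/-- If `t` is an edge from the identity of `a` to `v` that belongs to the stable class of
isomorphisms, then `e` belongs to a stable class if and only if `v ≫ e` does. -/
theorem constSimplex_comp_mem_stableEdges_iff [Q.RespectsIso] {t : (rigidHom X a a) _⦋1⦌}
    (ht : t ∈ stableEdges F (isomorphisms _))
    (hs : (rigidHom X a a).δ 1 t = rigidId X (op ⦋0⦌) a) :
    rigidComp (constSimplex ((rigidHom X a a).δ 0 t) _) e ∈ stableEdges F Q ↔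
      e ∈ stableEdges F Q := by
  obtain ⟨h₂, h₀, h₁⟩ := δ_interchangeσ₀ t e
  obtain ⟨h₂', h₀', h₁'⟩ := δ_interchangeσ₁ t e
  rw [stableEdges_δ₀_iff h₂' h₀' h₁' (comp_constSimplex_mem_stableEdges ht _),
    ← stableEdges_δ₂_iff h₂ h₀ h₁ (comp_constSimplex_mem_stableEdges ht _), hs,
    constSimplex_rigidId, rigidId_comp]

end ScaledSSet

/-! ### Explicit maps between low-dimensional simplices -/

namespace SimplexCategory

/-- The map `⦋1⦌ ⟶ ⦋m⦌` with the given values. -/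
def vec₁ {m : ℕ} (a b : Fin (m + 1)) (h : a ≤ b := by decide) : ⦋1⦌ ⟶ ⦋m⦌ :=
  mkHom ⟨![a, b], by
    rw [Fin.monotone_iff_le_succ]
    intro i
    fin_cases i
    exact h⟩

/-- The map `⦋2⦌ ⟶ ⦋m⦌` with the given values. -/
def vec₂ {m : ℕ} (a b c : Fin (m + 1)) (h : a ≤ b := by decide) (h' : b ≤ c := by decide) :
    ⦋2⦌ ⟶ ⦋m⦌ :=
  mkHom ⟨![a, b, c], by
    rw [Fin.monotone_iff_le_succ]
    intro i
    fin_cases i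
    exacts [h, h']⟩

/-- The map `⦋3⦌ ⟶ ⦋m⦌` with the given values. -/
def vec₃ {m : ℕ} (a b c d : Fin (m + 1)) (h : a ≤ b := by decide) (h' : b ≤ c := by decide)
    (h'' : c ≤ d := by decide) : ⦋3⦌ ⟶ ⦋m⦌ :=
  mkHom ⟨![a, b, c, d], by
    rw [Fin.monotone_iff_le_succ]
    intro i
    fin_cases i
    exacts [h, h', h'']⟩

theorem hom_ext_apply {n m : ℕ} {φ ψ : ⦋n⦌ ⟶ ⦋m⦌} (h : ∀ i, φ.toOrderHom i = ψ.toOrderHom i) :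
    φ = ψ :=
  Hom.ext _ _ (OrderHom.ext _ _ (funext h))

section

variable {m : ℕ} (a b c d : Fin (m + 1)) (h : a ≤ b) (h' : b ≤ c) (h'' : c ≤ d)

theorem δ₀_vec₃ : δ 0 ≫ vec₃ a b c d h h' h'' = vec₂ b c d h' h'' :=
  hom_ext_apply fun i ↦ by fin_cases i <;> rfl

theorem δ₁_vec₃ : δ 1 ≫ vec₃ a b c d h h' h'' = vec₂ a c d (h.trans h') h'' :=
  hom_ext_apply fun i ↦ by fin_cases i <;> rfl

theorem δ₂_vec₃ : δ 2 ≫ vec₃ a b c d h h' h'' = vec₂ a b d h (h'.trans h'') :=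
  hom_ext_apply fun i ↦ by fin_cases i <;> rfl

theorem δ₃_vec₃ : δ 3 ≫ vec₃ a b c d h h' h'' = vec₂ a b c h h' :=
  hom_ext_apply fun i ↦ by fin_cases i <;> rfl

theorem δ₀_vec₂ : δ 0 ≫ vec₂ a b c h h' = vec₁ b c h' :=
  hom_ext_apply fun i ↦ by fin_cases i <;> rfl

theorem δ₂_vec₂ : δ 2 ≫ vec₂ a b c h h' = vec₁ a b h :=
  hom_ext_apply fun i ↦ by fin_cases i <;> rfl

theorem vec₁_vec₃_fst : vec₁ 0 1 ≫ vec₃ a b c d h h' h'' = vec₁ a b h :=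
  hom_ext_apply fun i ↦ by fin_cases i <;> rfl

theorem vec₁_vec₃_snd : vec₁ 2 3 ≫ vec₃ a b c d h h' h'' = vec₁ c d h'' :=
  hom_ext_apply fun i ↦ by fin_cases i <;> rfl

end

end SimplexCategory

namespace SSet

open SimplexCategory

theorem vtx_map {X : SSet.{u}} {m n : ℕ} (φ : ⦋n⦌ ⟶ ⦋m⦌) (s : X _⦋m⦌) (i : Fin (n + 1)) :
    vtx (X.map φ.op s) i = vtx s (φ.toOrderHom i) := by
  rw [vtx, ← Functor.map_comp_apply, ← op_comp]
  rfl

end SSet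

namespace CategoryTheory.SimplicialThickening

instance {J : Type*} [LinearOrder J] {i j : SimplicialThickening J} (p q : i ⟶ j) :
    Subsingleton (p ⟶ q) :=
  ⟨fun _ _ ↦ InducedCategory.hom_ext (Subsingleton.elim _ _)⟩

/-- Paths form a poset, so a simplex of the nerve is determined by its vertices. -/
theorem nerve_ext {J : Type*} [LinearOrder J] {i j : SimplicialThickening J} {n : ℕ}
    {g g' : (nerve (i ⟶ j)).obj (op ⦋n⦌)}
    (h : ∀ k t, t ∈ (g.obj k).I ↔ t ∈ (g'.obj k).I) : g = g' :=
  Functor.ext (fun k ↦ hom_ext _ _ _ _ (h k)) (fun _ _ _ ↦ Subsingleton.elim _ _)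

/-- A chain of paths, as a simplex of the morphism object of the simplicial thickening. -/
def chain {J : Type*} [LinearOrder J] {i j : SimplicialThickening J} {n : ℕ}
    (p : Fin (n + 1) → (i ⟶ j)) (h : Monotone fun k ↦ (p k).I) :
    (nerve (i ⟶ j)).obj (op ⦋n⦌) where
  obj := p
  map f := ⟨⟨⟨h (leOfHom f)⟩⟩⟩

end CategoryTheory.SimplicialThickening

/-! ### Mapping-object simplices coming from edges, triangles and tetrahedra -/

namespace ScaledSSet

open SimplexCategory SimplicialThickening

variable {X : SSet.{u}}

/-- The simplices of the morphism objects of `ℭ[X]` that come from the simplicial thickening of a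
simplex of `X`. -/
def genSimplex {n : SimplexCategoryᵒᵖ} {m : ℕ} (s : X _⦋m⦌)
    {i j : SimplicialThickening (Fin (m + 1))} (g : (nerve (i ⟶ j)).obj n) {x y : X.Vertex}
    (hx : SSet.vtx s i.as = x) (hy : SSet.vtx s j.as = y) : (rigidHom X x y).obj n :=
  Quot.mk _ (.gen s i j g hx hy)

theorem genSimplex_map {n : SimplexCategoryᵒᵖ} {m m' : ℕ} (φ : ⦋m⦌ ⟶ ⦋m'⦌) (s : X _⦋m'⦌)
    {i j : SimplicialThickening (Fin (m + 1))} (g : (nerve (i ⟶ j)).obj n) {x y : X.Vertex}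
    (hx : SSet.vtx (X.map φ.op s) i.as = x) (hy : SSet.vtx (X.map φ.op s) j.as = y)
    (hx' : SSet.vtx s (φ.toOrderHom i.as) = x) (hy' : SSet.vtx s (φ.toOrderHom j.as) = y) :
    genSimplex (X.map φ.op s) g hx hy =
      genSimplex s (i := .mk (φ.toOrderHom i.as)) (j := .mk (φ.toOrderHom j.as))
        ((thickeningMap φ i j).app n g) hx' hy' :=
  Quot.sound (.gen_map φ s i j g hx hy hx' hy')

theorem genSimplex_comp {n : SimplexCategoryᵒᵖ} {m : ℕ} (s : X _⦋m⦌)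
    {i j k : SimplicialThickening (Fin (m + 1))} (g : (nerve (i ⟶ j)).obj n)
    (h : (nerve (j ⟶ k)).obj n) {x y z : X.Vertex}
    (hx : SSet.vtx s i.as = x) (hy : SSet.vtx s j.as = y) (hz : SSet.vtx s k.as = z) :
    genSimplex s (thickeningComp g h) hx hz =
      rigidComp (genSimplex s g hx hy) (genSimplex s h hy hz) :=
  Quot.sound (.gen_comp s i j k g h hx hy hz)

/-- The vertex of a morphism object of `ℭ[X]` given by an edge of `X`. -/
def edgeVertex (e : X _⦋1⦌) {x y : X.Vertex} (hx : SSet.vtx e 0 = x) (hy : SSet.vtx e 1 = y) :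
    (rigidHom X x y) _⦋0⦌ :=
  genSimplex e (i := .mk 0) (j := .mk 1)
    (chain (n := 0) (fun _ ↦ { I := Set.univ
                               left_le _ _ := Fin.zero_le _
                               le_right _ _ := Fin.le_last _ }) monotone_const) hx hy

/-- The edge of a morphism object of `ℭ[X]` given by a triangle of `X`, with prescribed
vertices. -/
def triEdge (s : X _⦋2⦌) {x y : X.Vertex} (hx : SSet.vtx s 0 = x) (hy : SSet.vtx s 2 = y) :
    (rigidHom X x y) _⦋1⦌ :=
  genSimplex s (i := .mk 0) (j := .mk 2) thickeningEdge hx hy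

theorem edgeVertex_map_const (x : X.Vertex) (e : X _⦋1⦌) (he : e = X.σ 0 x)
    (hx : SSet.vtx e 0 = x) (hy : SSet.vtx e 1 = x) :
    edgeVertex e hx hy = rigidId X (op ⦋0⦌) x := by
  subst he
  have h : SSet.vtx x 0 = x := constSimplex_zero x
  refine (genSimplex_map (σ (0 : Fin 1)) x _ hx hy h h).trans ?_
  refine Eq.trans ?_ (Quot.sound (.gen_id x (.mk 0) h))
  change genSimplex x _ _ _ = genSimplex x _ _ _
  congr 1
  refine nerve_ext fun k t ↦ ?_
  fin_cases t
  exact iff_of_true ⟨0, trivial, rfl⟩ rfl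

/-- The orientation is that of `{0, 2} ⊆ {0, 1, 2}`: a triangle is a 2-cell from its long edge to
the composite of its short edges. -/
theorem δ_triEdge (s : X _⦋2⦌) {x y z : X.Vertex} (hx : SSet.vtx s 0 = x)
    (hy : SSet.vtx s 1 = y) (hz : SSet.vtx s 2 = z) :
    (rigidHom X x z).δ 1 (triEdge s hx hz) =
        edgeVertex (X.map (vec₁ 0 2).op s) ((SSet.vtx_map _ _ _).trans hx)
          ((SSet.vtx_map _ _ _).trans hz) ∧
      (rigidHom X x z).δ 0 (triEdge s hx hz) =
        rigidComp
          (edgeVertex (X.map (vec₁ 0 1).op s) ((SSet.vtx_map _ _ _).trans hx)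
            ((SSet.vtx_map _ _ _).trans hy))
          (edgeVertex (X.map (vec₁ 1 2).op s) ((SSet.vtx_map _ _ _).trans hy)
            ((SSet.vtx_map _ _ _).trans hz)) := by
  constructor
  · refine Eq.trans ?_ (genSimplex_map _ _ _ _ _ hx hz).symm
    change genSimplex s _ _ _ = genSimplex s _ _ _
    congr 1
    refine nerve_ext fun k t ↦ ?_
    obtain rfl : k = 0 := Fin.fin_one_eq_zero k
    change t ∈ ({0, 2} : Set (Fin 3)) ↔ ∃ a : Fin 2, a ∈ Set.univ ∧ (![0, 2] : Fin 2 → Fin 3) a = t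
    simp [Fin.exists_fin_two, eq_comm]
  · rw [edgeVertex, edgeVertex, genSimplex_map _ _ _ _ _ hx hy, genSimplex_map _ _ _ _ _ hy hz]
    refine Eq.trans ?_ (genSimplex_comp _ _ _ _ _ _)
    change genSimplex s _ _ _ = genSimplex s _ _ _
    congr 1
    refine nerve_ext fun k t ↦ ?_
    obtain rfl : k = 0 := Fin.fin_one_eq_zero k
    change t ∈ Set.univ ↔
      (∃ a : Fin 2, a ∈ Set.univ ∧ (![0, 1] : Fin 2 → Fin 3) a = t) ∨
        (∃ a : Fin 2, a ∈ Set.univ ∧ (![1, 2] : Fin 2 → Fin 3) a = t)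
    simp [Fin.exists_fin_two]
    fin_cases t <;> simp

theorem constSimplex_edgeVertex (e : X _⦋1⦌) {x y : X.Vertex} (hx : SSet.vtx e 0 = x)
    (hy : SSet.vtx e 1 = y) (n : ℕ) :
    constSimplex (edgeVertex e hx hy) (op ⦋n⦌) =
      genSimplex e (i := .mk 0) (j := .mk 1)
        (chain (n := n) (fun _ ↦ { I := Set.univ
                                   left_le _ _ := Fin.zero_le _
                                   le_right _ _ := Fin.le_last _ }) monotone_const) hx hy :=
  rfl

/-- The chain of paths from `0` to `3` through the given set of vertices and the whole set. -/
def tetrahedronChain (S : Set (Fin 4)) (h₀ : 0 ∈ S) (h₃ : 3 ∈ S) :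
    (nerve (SimplicialThickening.mk (0 : Fin 4) ⟶ .mk 3)).obj (op ⦋2⦌) :=
  chain (i := .mk 0) (j := .mk 3)
    ![{ I := {0, 3}
        left_le := fun _ _ ↦ Fin.zero_le _
        le_right := fun _ _ ↦ Fin.le_last _ },
      { I := S
        left := h₀
        right := h₃
        left_le := fun _ _ ↦ Fin.zero_le _
        le_right := fun _ _ ↦ Fin.le_last _ },
      { I := Set.univ
        left_le := fun _ _ ↦ Fin.zero_le _
        le_right := fun _ _ ↦ Fin.le_last _ }]
    (by
      rw [Fin.monotone_iff_le_succ]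
      intro i
      fin_cases i
      · rintro t (rfl | rfl)
        exacts [h₀, h₃]
      · exact Set.subset_univ _)

/-- Paths from 0 to 3 are ordered by which of 1 and 2 they contain, so the mapping object is a
square. The chains through `{0, 1, 3}` and `{0, 2, 3}` are its two triangles: `t` is 013 followed by
01·123, `t'` is 023 followed by 012·23, and they share the diagonal `{0, 3} ⊆ {0, 1, 2, 3}`. -/
theorem exists_diagonal_of_tetrahedron (s : X _⦋3⦌) {x₀ x₁ x₂ x₃ : X.Vertex}
    (h₀ : SSet.vtx s 0 = x₀) (h₁ : SSet.vtx s 1 = x₁) (h₂ : SSet.vtx s 2 = x₂)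
    (h₃ : SSet.vtx s 3 = x₃) :
    ∃ (d : (rigidHom X x₀ x₃) _⦋1⦌) (t t' : (rigidHom X x₀ x₃) _⦋2⦌),
      ((rigidHom X x₀ x₃).δ 2 t = triEdge (X.δ 2 s) ((SSet.vtx_map _ _ _).trans h₀)
          ((SSet.vtx_map _ _ _).trans h₃) ∧
        (rigidHom X x₀ x₃).δ 0 t = rigidComp
          (constSimplex (edgeVertex (X.map (vec₁ 0 1).op s) ((SSet.vtx_map _ _ _).trans h₀)
            ((SSet.vtx_map _ _ _).trans h₁)) _)
          (triEdge (X.δ 0 s) ((SSet.vtx_map _ _ _).trans h₁)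
            ((SSet.vtx_map _ _ _).trans h₃)) ∧
        (rigidHom X x₀ x₃).δ 1 t = d) ∧
      ((rigidHom X x₀ x₃).δ 2 t' = triEdge (X.δ 1 s) ((SSet.vtx_map _ _ _).trans h₀)
          ((SSet.vtx_map _ _ _).trans h₃) ∧
        (rigidHom X x₀ x₃).δ 0 t' = rigidComp
          (triEdge (X.δ 3 s) ((SSet.vtx_map _ _ _).trans h₀)
            ((SSet.vtx_map _ _ _).trans h₂))
          (constSimplex (edgeVertex (X.map (vec₁ 2 3).op s) ((SSet.vtx_map _ _ _).trans h₂)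
            ((SSet.vtx_map _ _ _).trans h₃)) _) ∧
        (rigidHom X x₀ x₃).δ 1 t' = d) := by
  refine ⟨(rigidHom X x₀ x₃).δ 1 (genSimplex s (tetrahedronChain {0, 1, 3} (by simp) (by simp))
      h₀ h₃), genSimplex s (tetrahedronChain {0, 1, 3} (by simp) (by simp)) h₀ h₃,
    genSimplex s (tetrahedronChain {0, 2, 3} (by simp) (by simp)) h₀ h₃,
    ⟨?_, ?_, rfl⟩, ⟨?_, ?_, ?_⟩⟩
  · refine Eq.trans ?_ (genSimplex_map _ _ _ _ _ h₀ h₃).symm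
    change genSimplex s _ _ _ = genSimplex s _ _ _
    congr 1
    refine nerve_ext fun k t ↦ ?_
    fin_cases k
    · change t ∈ ({0, 3} : Set (Fin 4)) ↔
        ∃ a : Fin 3, a ∈ ({0, 2} : Set (Fin 3)) ∧ (2 : Fin 4).succAbove a = t
      fin_cases t <;> simp <;> decide
    · change t ∈ ({0, 1, 3} : Set (Fin 4)) ↔
        ∃ a : Fin 3, a ∈ Set.univ ∧ (2 : Fin 4).succAbove a = t
      fin_cases t <;> simp [Fin.exists_fin_succ] <;> decide
  · refine Eq.trans ?_ (congrArg₂ rigidComp ((constSimplex_edgeVertex _ _ _ _).trans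
      (genSimplex_map _ _ _ _ _ h₀ h₁)) (genSimplex_map _ _ _ _ _ h₁ h₃)).symm
    refine Eq.trans ?_ (genSimplex_comp _ _ _ _ _ _)
    change genSimplex s _ _ _ = genSimplex s _ _ _
    congr 1
    refine nerve_ext fun k t ↦ ?_
    fin_cases k
    · change t ∈ ({0, 1, 3} : Set (Fin 4)) ↔
        (∃ a : Fin 2, a ∈ Set.univ ∧ (![0, 1] : Fin 2 → Fin 4) a = t) ∨
        (∃ a : Fin 3, a ∈ ({0, 2} : Set (Fin 3)) ∧ (0 : Fin 4).succAbove a = t)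
      fin_cases t <;> simp [Fin.exists_fin_succ]
    · change t ∈ Set.univ ↔
        (∃ a : Fin 2, a ∈ Set.univ ∧ (![0, 1] : Fin 2 → Fin 4) a = t) ∨
        (∃ a : Fin 3, a ∈ Set.univ ∧ (0 : Fin 4).succAbove a = t)
      fin_cases t <;> simp [Fin.exists_fin_succ]
  · refine Eq.trans ?_ (genSimplex_map _ _ _ _ _ h₀ h₃).symm
    change genSimplex s _ _ _ = genSimplex s _ _ _
    congr 1
    refine nerve_ext fun k t ↦ ?_
    fin_cases k
    · change t ∈ ({0, 3} : Set (Fin 4)) ↔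
        ∃ a : Fin 3, a ∈ ({0, 2} : Set (Fin 3)) ∧ (1 : Fin 4).succAbove a = t
      fin_cases t <;> simp <;> decide
    · change t ∈ ({0, 2, 3} : Set (Fin 4)) ↔
        ∃ a : Fin 3, a ∈ Set.univ ∧ (1 : Fin 4).succAbove a = t
      fin_cases t <;> simp [Fin.exists_fin_succ]
  · refine Eq.trans ?_ (congrArg₂ rigidComp (genSimplex_map _ _ _ _ _ h₀ h₂)
      ((constSimplex_edgeVertex _ _ _ _).trans (genSimplex_map _ _ _ _ _ h₂ h₃))).symm
    refine Eq.trans ?_ (genSimplex_comp _ _ _ _ _ _)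
    change genSimplex s _ _ _ = genSimplex s _ _ _
    congr 1
    refine nerve_ext fun k t ↦ ?_
    fin_cases k
    · change t ∈ ({0, 2, 3} : Set (Fin 4)) ↔
        (∃ a : Fin 3, a ∈ ({0, 2} : Set (Fin 3)) ∧ (3 : Fin 4).succAbove a = t) ∨
        (∃ a : Fin 2, a ∈ Set.univ ∧ (![2, 3] : Fin 2 → Fin 4) a = t)
      fin_cases t <;> simp [Fin.exists_fin_succ] <;> decide
    · change t ∈ Set.univ ↔
        (∃ a : Fin 3, a ∈ Set.univ ∧ (3 : Fin 4).succAbove a = t) ∨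
        (∃ a : Fin 2, a ∈ Set.univ ∧ (![2, 3] : Fin 2 → Fin 4) a = t)
      fin_cases t <;> simp [Fin.exists_fin_succ] <;> decide
  -- The face `δ 1` forgets the intermediate path, the only place where the two chains differ.
  · change genSimplex s _ _ _ = genSimplex s _ _ _
    congr 1
    refine nerve_ext fun k t ↦ ?_
    fin_cases k <;> rfl

end ScaledSSet

/-! ### Stability of the faces of a tetrahedron -/

namespace ScaledSSet

open SimplexCategory MorphismProperty

section

variable {X : SSet.{u}} {x y : X.Vertex} {Z : SSet.{u}} (F : rigidHom X x y ⟶ Z)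
  (Q : MorphismProperty ((SSet.truncation 2).obj Z).HomotopyCategory)

/-- A triangle is stable if the corresponding edge of a morphism object of `ℭ[X]` is. -/
def IsStable (t : X _⦋2⦌) : Prop :=
  triEdge t rfl rfl ∈ stableEdges F Q

/-- The composite of a triangle with a subsequent edge is stable. -/
def IsStableRight (t : X _⦋2⦌) (e : X _⦋1⦌) : Prop :=
  ∃ h : SSet.vtx t 2 = SSet.vtx e 0,
    rigidComp (triEdge t rfl h) (constSimplex (edgeVertex e rfl rfl) _) ∈ stableEdges F Q

/-- The composite of an edge with a subsequent triangle is stable. -/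
def IsStableLeft (e : X _⦋1⦌) (t : X _⦋2⦌) : Prop :=
  ∃ h : SSet.vtx t 0 = SSet.vtx e 1,
    rigidComp (constSimplex (edgeVertex e rfl rfl) _) (triEdge t h rfl) ∈ stableEdges F Q

variable {F Q}

theorem isStable_iff {t : X _⦋2⦌} {a b : X.Vertex} (ha : SSet.vtx t 0 = a)
    (hb : SSet.vtx t 2 = b) : triEdge t ha hb ∈ stableEdges F Q ↔ IsStable F Q t := by
  subst ha hb
  rfl

theorem isStableRight_iff {t : X _⦋2⦌} {e : X _⦋1⦌} {a b c : X.Vertex} (ha : SSet.vtx t 0 = a)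
    (hb : SSet.vtx t 2 = b) (hb' : SSet.vtx e 0 = b) (hc : SSet.vtx e 1 = c) :
    rigidComp (triEdge t ha hb) (constSimplex (edgeVertex e hb' hc) _) ∈ stableEdges F Q ↔
      IsStableRight F Q t e := by
  subst ha hb' hc
  exact ⟨fun h ↦ ⟨hb, h⟩, fun ⟨_, h⟩ ↦ h⟩

theorem isStableLeft_iff {t : X _⦋2⦌} {e : X _⦋1⦌} {a b c : X.Vertex} (ha : SSet.vtx t 0 = a)
    (hb : SSet.vtx t 2 = b) (hc : SSet.vtx e 0 = c) (ha' : SSet.vtx e 1 = a) :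
    rigidComp (constSimplex (edgeVertex e hc ha') _) (triEdge t ha hb) ∈ stableEdges F Q ↔
      IsStableLeft F Q e t := by
  subst ha' hb hc
  exact ⟨fun h ↦ ⟨ha, h⟩, fun ⟨_, h⟩ ↦ h⟩

theorem IsStable.right {t : X _⦋2⦌} (h : IsStable F Q t) {e : X _⦋1⦌}
    (he : SSet.vtx t 2 = SSet.vtx e 0) : IsStableRight F Q t e :=
  ⟨he, comp_constSimplex_mem_stableEdges ((isStable_iff _ _).2 h) _⟩

theorem IsStable.left {t : X _⦋2⦌} (h : IsStable F Q t) {e : X _⦋1⦌}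
    (he : SSet.vtx t 0 = SSet.vtx e 1) : IsStableLeft F Q e t :=
  ⟨he, constSimplex_comp_mem_stableEdges ((isStable_iff _ _).2 h) _⟩

/-- A retraction in the direction of the target of a stable triangle can be undone if the
composite with it is. -/
theorem IsStableRight.cancel [Q.RespectsIso] {t u : X _⦋2⦌} {e : X _⦋1⦌} (h : IsStableRight F Q t e)
    (hu : IsStable F (isomorphisms _) u) (hue : X.map (vec₁ 0 1).op u = e)
    (hu' : X.map (vec₁ 0 2).op u ∈ X.degenerate 1) : IsStable F Q t := by
  subst hue
  obtain ⟨v, hv⟩ := SSet.exists_of_mem_degenerate_one hu'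
  have hu₀ : SSet.vtx u 0 = v := by
    have := SSet.vtx_map (vec₁ 0 2) u 0
    rw [← hv] at this
    exact this.symm.trans ((SSet.vtx_map (σ 0) v 0).trans (constSimplex_zero v))
  have hu₂ : SSet.vtx u 2 = v := by
    have := SSet.vtx_map (vec₁ 0 2) u 1
    rw [← hv] at this
    exact this.symm.trans ((SSet.vtx_map (σ 0) v 1).trans (constSimplex_zero v))
  obtain ⟨ht, h⟩ := h
  have ht' : SSet.vtx t 2 = v := ht.trans ((SSet.vtx_map _ _ _).trans hu₀)
  obtain ⟨h₁, h₀⟩ := δ_triEdge u hu₀ rfl hu₂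
  -- The triangle `u` is a stably invertible 2-cell from an identity to the composite of `e` with
  -- the edge 12 of `u`. Hence `t` may be replaced by its composite with both edges, which is a
  -- whiskering of the given `t` followed by `e`.
  rw [← isStable_iff rfl ht', ← comp_constSimplex_mem_stableEdges_iff
    ((isStable_iff hu₀ hu₂).2 hu), h₀, constSimplex_rigidComp, ← rigidComp_assoc]
  · exact comp_constSimplex_mem_stableEdges ((isStableRight_iff _ _ _ _).2 ⟨ht, h⟩) _
  · rw [h₁]
    exact edgeVertex_map_const _ _ hv.symm _ _

/-- Mirror image of `IsStableRight.cancel`: here `e` is the second short edge of `u`, so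
precomposing with the first one cancels it. -/
theorem IsStableLeft.cancel [Q.RespectsIso] {t u : X _⦋2⦌} {e : X _⦋1⦌} (h : IsStableLeft F Q e t)
    (hu : IsStable F (isomorphisms _) u) (hue : X.map (vec₁ 1 2).op u = e)
    (hu' : X.map (vec₁ 0 2).op u ∈ X.degenerate 1) : IsStable F Q t := by
  subst hue
  obtain ⟨v, hv⟩ := SSet.exists_of_mem_degenerate_one hu'
  have hu₀ : SSet.vtx u 0 = v := by
    have := SSet.vtx_map (vec₁ 0 2) u 0
    rw [← hv] at this
    exact this.symm.trans ((SSet.vtx_map (σ 0) v 0).trans (constSimplex_zero v))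
  have hu₂ : SSet.vtx u 2 = v := by
    have := SSet.vtx_map (vec₁ 0 2) u 1
    rw [← hv] at this
    exact this.symm.trans ((SSet.vtx_map (σ 0) v 1).trans (constSimplex_zero v))
  obtain ⟨ht, h⟩ := h
  have ht' : SSet.vtx t 0 = v := ht.trans ((SSet.vtx_map _ _ _).trans hu₂)
  obtain ⟨h₁, h₀⟩ := δ_triEdge u hu₀ rfl hu₂
  rw [← isStable_iff ht' rfl, ← constSimplex_comp_mem_stableEdges_iff
    ((isStable_iff hu₀ hu₂).2 hu), h₀, constSimplex_rigidComp, rigidComp_assoc]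
  · exact constSimplex_comp_mem_stableEdges ((isStableLeft_iff _ _ _ _).2 ⟨ht, h⟩) _
  · rw [h₁]
    exact edgeVertex_map_const _ _ hv.symm _ _

theorem isStable_iff_splitMonos_and_splitEpis {t : X _⦋2⦌} :
    IsStable F (isomorphisms _) t ↔ IsStable F (splitMonos _) t ∧ IsStable F (splitEpis _) t :=
  stableEdges_isomorphisms_iff

section

variable {s : X _⦋3⦌}

/-- In the square 013 then 01·123 equals 023 then 012·23, the edges given by 013 and 012 are
invertible, so the property passes between the remaining two through the diagonal. -/
theorem isStable_δ₁_iff [Q.RespectsIso] (h₀₁₂ : IsStable F (isomorphisms _) (X.δ 3 s))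
    (h₀₁₃ : IsStable F (isomorphisms _) (X.δ 2 s)) :
    IsStable F Q (X.δ 1 s) ↔ IsStableLeft F Q (X.map (vec₁ 0 1).op s) (X.δ 0 s) := by
  obtain ⟨d, t, t', ⟨h₂, h₀, h₁⟩, ⟨h₂', h₀', h₁'⟩⟩ :=
    exists_diagonal_of_tetrahedron s rfl rfl rfl rfl
  exact (isStable_iff _ _).symm.trans <| (stableEdges_δ₂_iff h₂' h₀' h₁'
    (comp_constSimplex_mem_stableEdges ((isStable_iff _ _).2 h₀₁₂) _)).trans <|
    (stableEdges_δ₀_iff h₂ h₀ h₁ ((isStable_iff _ _).2 h₀₁₃)).symm.trans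
      (isStableLeft_iff _ _ _ _)

theorem isStable_δ₂_iff [Q.RespectsIso] (h₀₂₃ : IsStable F (isomorphisms _) (X.δ 1 s))
    (h₁₂₃ : IsStable F (isomorphisms _) (X.δ 0 s)) :
    IsStable F Q (X.δ 2 s) ↔ IsStableRight F Q (X.δ 3 s) (X.map (vec₁ 2 3).op s) := by
  obtain ⟨d, t, t', ⟨h₂, h₀, h₁⟩, ⟨h₂', h₀', h₁'⟩⟩ :=
    exists_diagonal_of_tetrahedron s rfl rfl rfl rfl
  exact (isStable_iff _ _).symm.trans <| (stableEdges_δ₂_iff h₂ h₀ h₁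
    (constSimplex_comp_mem_stableEdges ((isStable_iff _ _).2 h₁₂₃) _)).trans <|
    (stableEdges_δ₀_iff h₂' h₀' h₁' ((isStable_iff _ _).2 h₀₂₃)).symm.trans
      (isStableRight_iff _ _ _ _)

theorem isStable_δ₁ (h₀₁₂ : IsStable F (isomorphisms _) (X.δ 3 s))
    (h₀₁₃ : IsStable F (isomorphisms _) (X.δ 2 s))
    (h₁₂₃ : IsStable F (isomorphisms _) (X.δ 0 s)) :
    IsStable F (isomorphisms _) (X.δ 1 s) :=
  (isStable_δ₁_iff h₀₁₂ h₀₁₃).2 (h₁₂₃.left (by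
    rw [SSet.vtx_map]
    exact SSet.vtx_map (δ 0) s 0))

theorem isStable_δ₂ (h₀₁₂ : IsStable F (isomorphisms _) (X.δ 3 s))
    (h₀₂₃ : IsStable F (isomorphisms _) (X.δ 1 s))
    (h₁₂₃ : IsStable F (isomorphisms _) (X.δ 0 s)) :
    IsStable F (isomorphisms _) (X.δ 2 s) :=
  (isStable_δ₂_iff h₀₂₃ h₁₂₃).2 (h₀₁₂.right (by
    rw [SSet.vtx_map]
    exact SSet.vtx_map (δ 3) s 2))

/-- The path 013 then 01·123 makes the diagonal invertible. Along the other path, the first factor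
of an isomorphism is a split monomorphism and the second a split epimorphism. -/
theorem isStable_splitMonos_δ₁ (h₀₁₃ : IsStable F (isomorphisms _) (X.δ 2 s))
    (h₁₂₃ : IsStable F (isomorphisms _) (X.δ 0 s)) :
    IsStable F (splitMonos _) (X.δ 1 s) ∧
      IsStableRight F (splitEpis _) (X.δ 3 s) (X.map (vec₁ 2 3).op s) := by
  obtain ⟨d, t, t', ⟨h₂, h₀, h₁⟩, ⟨h₂', h₀', h₁'⟩⟩ :=
    exists_diagonal_of_tetrahedron s rfl rfl rfl rfl
  have hd := (stableEdges_δ₂_iff h₂ h₀ h₁ (constSimplex_comp_mem_stableEdges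
      ((isStable_iff _ _).2 h₁₂₃) _)).1 ((isStable_iff _ _).2 h₀₁₃)
  rw [stableEdges_isomorphisms_iff] at hd
  exact ⟨(isStable_iff _ _).1 (stableEdges_splitMonos_δ₂ h₂' h₁' hd.1),
    (isStableRight_iff _ _ _ _).1 (stableEdges_splitEpis_δ₀ h₀' h₁' hd.2)⟩

/-- The same with the two paths exchanged: 023 then 012·23 inverts the diagonal, and 013 then 01·123
is the resulting factorization. -/
theorem isStable_splitMonos_δ₂ (h₀₂₃ : IsStable F (isomorphisms _) (X.δ 1 s))
    (h₀₁₂ : IsStable F (isomorphisms _) (X.δ 3 s)) :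
    IsStable F (splitMonos _) (X.δ 2 s) ∧
      IsStableLeft F (splitEpis _) (X.map (vec₁ 0 1).op s) (X.δ 0 s) := by
  obtain ⟨d, t, t', ⟨h₂, h₀, h₁⟩, ⟨h₂', h₀', h₁'⟩⟩ :=
    exists_diagonal_of_tetrahedron s rfl rfl rfl rfl
  have hd := (stableEdges_δ₂_iff h₂' h₀' h₁' (comp_constSimplex_mem_stableEdges
      ((isStable_iff _ _).2 h₀₁₂) _)).1 ((isStable_iff _ _).2 h₀₂₃)
  rw [stableEdges_isomorphisms_iff] at hd
  exact ⟨(isStable_iff _ _).1 (stableEdges_splitMonos_δ₂ h₂ h₁ hd.1),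
    (isStableLeft_iff _ _ _ _).1 (stableEdges_splitEpis_δ₀ h₀ h₁ hd.2)⟩

end

end

end ScaledSSet

/-! ### Simplices of a product and Gray-thin triangles -/

namespace ScaledSSet

open SimplexCategory MorphismProperty

section

variable {C D : SSet.{u}}

/-- The simplex of a product with given reindexings of a simplex of each factor as components. -/
def bisimplex {m k n : ℕ} (α : C _⦋m⦌) (β : D _⦋k⦌) (φ : ⦋n⦌ ⟶ ⦋m⦌) (ψ : ⦋n⦌ ⟶ ⦋k⦌) :
    (C ⊗ D : SSet.{u}) _⦋n⦌ :=
  (C.map φ.op α, D.map ψ.op β)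

theorem map_bisimplex {m k n n' : ℕ} (α : C _⦋m⦌) (β : D _⦋k⦌) (φ : ⦋n⦌ ⟶ ⦋m⦌)
    (ψ : ⦋n⦌ ⟶ ⦋k⦌) (θ : ⦋n'⦌ ⟶ ⦋n⦌) :
    (C ⊗ D : SSet.{u}).map θ.op (bisimplex α β φ ψ) = bisimplex α β (θ ≫ φ) (θ ≫ ψ) := by
  have h₁ : C.map θ.op (C.map φ.op α) = C.map (θ ≫ φ).op α := by
    rw [op_comp, Functor.map_comp_apply]
  have h₂ : D.map θ.op (D.map ψ.op β) = D.map (θ ≫ ψ).op β := by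
    rw [op_comp, Functor.map_comp_apply]
  exact Prod.ext h₁ h₂

theorem bisimplex_map {m m' k k' n : ℕ} (α : C _⦋m'⦌) (β : D _⦋k'⦌) (φ : ⦋n⦌ ⟶ ⦋m⦌)
    (ψ : ⦋n⦌ ⟶ ⦋k⦌) (φ' : ⦋m⦌ ⟶ ⦋m'⦌) (ψ' : ⦋k⦌ ⟶ ⦋k'⦌) :
    bisimplex (C.map φ'.op α) (D.map ψ'.op β) φ ψ = bisimplex α β (φ ≫ φ') (ψ ≫ ψ') := by
  have h₁ : C.map φ.op (C.map φ'.op α) = C.map (φ ≫ φ').op α := by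
    rw [op_comp, Functor.map_comp_apply]
  have h₂ : D.map ψ.op (D.map ψ'.op β) = D.map (ψ ≫ ψ').op β := by
    rw [op_comp, Functor.map_comp_apply]
  exact Prod.ext h₁ h₂

/-- The tetrahedron of a product with given vertices in a pair of simplices. -/
abbrev tetra {m k : ℕ} (α : C _⦋m⦌) (β : D _⦋k⦌) (a b c d : Fin (m + 1))
    (a' b' c' d' : Fin (k + 1)) (h₁ : a ≤ b := by decide) (h₂ : b ≤ c := by decide)
    (h₃ : c ≤ d := by decide) (h₁' : a' ≤ b' := by decide) (h₂' : b' ≤ c' := by decide)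
    (h₃' : c' ≤ d' := by decide) : (C ⊗ D : SSet.{u}) _⦋3⦌ :=
  bisimplex α β (vec₃ a b c d h₁ h₂ h₃) (vec₃ a' b' c' d' h₁' h₂' h₃')

/-- The triangle of a product with given vertices in a pair of simplices. -/
abbrev tri₂ {m k : ℕ} (α : C _⦋m⦌) (β : D _⦋k⦌) (a b c : Fin (m + 1))
    (a' b' c' : Fin (k + 1)) (h₁ : a ≤ b := by decide) (h₂ : b ≤ c := by decide)
    (h₁' : a' ≤ b' := by decide) (h₂' : b' ≤ c' := by decide) : (C ⊗ D : SSet.{u}) _⦋2⦌ :=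
  bisimplex α β (vec₂ a b c h₁ h₂) (vec₂ a' b' c' h₁' h₂')

/-- The edge of a product with given vertices in a pair of simplices. -/
abbrev edge₂ {m k : ℕ} (α : C _⦋m⦌) (β : D _⦋k⦌) (a b : Fin (m + 1))
    (a' b' : Fin (k + 1)) (h₁ : a ≤ b := by decide) (h₁' : a' ≤ b' := by decide) :
    (C ⊗ D : SSet.{u}) _⦋1⦌ :=
  bisimplex α β (vec₁ a b h₁) (vec₁ a' b' h₁')

/-- The triangle in a square of a product of two edges that passes first along the second one
and then along the first one. -/
abbrev squareTriangle (g : C _⦋1⦌) (r : D _⦋1⦌) : (C ⊗ D : SSet.{u}) _⦋2⦌ :=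
  tri₂ g r 0 0 1 0 1 1

section

variable {m k : ℕ} (α : C _⦋m⦌) (β : D _⦋k⦌) (a b c d : Fin (m + 1))
    (a' b' c' d' : Fin (k + 1)) (h₁ : a ≤ b) (h₂ : b ≤ c)
    (h₃ : c ≤ d) (h₁' : a' ≤ b') (h₂' : b' ≤ c')
    (h₃' : c' ≤ d')

theorem δ₀_tetra : (C ⊗ D : SSet.{u}).δ 0 (tetra α β a b c d a' b' c' d' h₁ h₂ h₃ h₁' h₂' h₃') =
    tri₂ α β b c d b' c' d' h₂ h₃ h₂' h₃' :=
  (map_bisimplex _ _ _ _ (δ 0)).trans (by rw [δ₀_vec₃, δ₀_vec₃])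

theorem δ₁_tetra : (C ⊗ D : SSet.{u}).δ 1 (tetra α β a b c d a' b' c' d' h₁ h₂ h₃ h₁' h₂' h₃') =
    tri₂ α β a c d a' c' d' (h₁.trans h₂) h₃ (h₁'.trans h₂') h₃' :=
  (map_bisimplex _ _ _ _ (δ 1)).trans (by rw [δ₁_vec₃, δ₁_vec₃])

theorem δ₂_tetra : (C ⊗ D : SSet.{u}).δ 2 (tetra α β a b c d a' b' c' d' h₁ h₂ h₃ h₁' h₂' h₃') =
    tri₂ α β a b d a' b' d' h₁ (h₂.trans h₃) h₁' (h₂'.trans h₃') :=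
  (map_bisimplex _ _ _ _ (δ 2)).trans (by rw [δ₂_vec₃, δ₂_vec₃])

theorem δ₃_tetra : (C ⊗ D : SSet.{u}).δ 3 (tetra α β a b c d a' b' c' d' h₁ h₂ h₃ h₁' h₂' h₃') =
    tri₂ α β a b c a' b' c' h₁ h₂ h₁' h₂' :=
  (map_bisimplex _ _ _ _ (δ 3)).trans (by rw [δ₃_vec₃, δ₃_vec₃])

theorem fst_edge_tetra : (C ⊗ D : SSet.{u}).map (vec₁ 0 1).op
    (tetra α β a b c d a' b' c' d' h₁ h₂ h₃ h₁' h₂' h₃') = edge₂ α β a b a' b' h₁ h₁' :=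
  (map_bisimplex _ _ _ _ _).trans (by rw [vec₁_vec₃_fst, vec₁_vec₃_fst])

theorem snd_edge_tetra : (C ⊗ D : SSet.{u}).map (vec₁ 2 3).op
    (tetra α β a b c d a' b' c' d' h₁ h₂ h₃ h₁' h₂' h₃') = edge₂ α β c d c' d' h₃ h₃' :=
  (map_bisimplex _ _ _ _ _).trans (by rw [vec₁_vec₃_snd, vec₁_vec₃_snd])

theorem squareTriangle_map : squareTriangle (C.map (vec₁ a b h₁).op α) (D.map (vec₁ a' b' h₁').op β) =
    tri₂ α β a a b a' b' b' le_rfl h₁ h₁' le_rfl := by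
  refine (bisimplex_map _ _ _ _ _ _).trans ?_
  congr 1 <;> exact hom_ext_apply fun i ↦ by fin_cases i <;> rfl

end

end

section

variable {C D : ScaledSSet.{u}} {x y : C.toSSet.Vertex × D.toSSet.Vertex} {Z : SSet.{u}}
  {F : rigidHom (C.toSSet ⊗ D.toSSet) x y ⟶ Z}
  {m k : ℕ} {α : C.toSSet _⦋m⦌} {β : D.toSSet _⦋k⦌}

/-- A whiskering of the edge of a thin triangle is a composite of it with degenerate edges, hence is
itself marked. -/
theorem isStable_of_mem_grayTriangles
    (hF : ∀ e ∈ ((gray C D).mor x y).marked, SSet.IsEquivalenceEdge (F.app _ e))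
    {t : (C.toSSet ⊗ D.toSSet : SSet.{u}) _⦋2⦌} (ht : t ∈ grayTriangles C D) :
    IsStable F (isomorphisms _) t := by
  intro l r
  have h : IsRigidMarked (gray C D) (triangleEdge t) := .thin (X := gray C D) t ht
  exact hF _ (.comp (X := gray C D) (.comp (X := gray C D)
    (.degenerate (X := gray C D) _ (constSimplex_mem_degenerate _)) h)
    (.degenerate (X := gray C D) _ (constSimplex_mem_degenerate _)))

theorem map_vec₂_mem_degenerate {X : SSet.{u}} {s : X _⦋m⦌} {a b c : Fin (m + 1)} {h₁ : a ≤ b}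
    {h₂ : b ≤ c} (h : a = b ∨ b = c) : X.map (vec₂ a b c h₁ h₂).op s ∈ X.degenerate 2 := by
  obtain rfl | rfl := h
  · have : vec₂ a a c h₁ h₂ = σ 0 ≫ vec₁ a c h₂ :=
      hom_ext_apply fun i ↦ by fin_cases i <;> rfl
    exact ⟨1, by simp, σ 0, X.map (vec₁ a c h₂).op s, by
      rw [this, op_comp, Functor.map_comp_apply]⟩
  · have : vec₂ a b b h₁ h₂ = σ 1 ≫ vec₁ a b h₁ :=
      hom_ext_apply fun i ↦ by fin_cases i <;> rfl
    exact ⟨1, by simp, σ 1, X.map (vec₁ a b h₁).op s, by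
      rw [this, op_comp, Functor.map_comp_apply]⟩

theorem map_vec₁_mem_degenerate {X : SSet.{u}} (s : X _⦋m⦌) (a : Fin (m + 1)) :
    X.map (vec₁ a a le_rfl).op s ∈ X.degenerate 1 := by
  have : vec₁ a a le_rfl = σ 0 ≫ const ⦋0⦌ ⦋m⦌ a :=
    hom_ext_apply fun i ↦ by fin_cases i <;> rfl
  exact ⟨0, by simp, σ 0, X.map (const ⦋0⦌ ⦋m⦌ a).op s, by
    rw [this, op_comp, Functor.map_comp_apply]⟩

theorem δ_map {X : SSet.{u}} (s : X _⦋m⦌) (φ : ⦋2⦌ ⟶ ⦋m⦌) (i : Fin 3) :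
    X.δ i (X.map φ.op s) = X.map (δ i ≫ φ).op s :=
  (Functor.map_comp_apply X φ.op (δ i).op s).symm

theorem tri₂_mem_grayTriangles (hα : α ∈ C.core.obj (op ⦋m⦌)) (hβ : β ∈ D.core.obj (op ⦋k⦌))
    {a b c : Fin (m + 1)} {a' b' c' : Fin (k + 1)} {h₁ : a ≤ b} {h₂ : b ≤ c} {h₁' : a' ≤ b'}
    {h₂' : b' ≤ c'} (h : b = c ∨ a' = b') :
    tri₂ α β a b c a' b' c' h₁ h₂ h₁' h₂' ∈ grayTriangles C D := by
  refine ⟨⟨hα _, hβ _⟩, ?_⟩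
  obtain rfl | rfl := h
  · refine Or.inl ⟨map_vec₂_mem_degenerate (.inr rfl), ?_⟩
    change C.toSSet.δ 0 (C.toSSet.map (vec₂ a b b h₁ h₂).op α) ∈ _
    rw [δ_map, δ₀_vec₂]
    exact map_vec₁_mem_degenerate _ _
  · refine Or.inr ⟨map_vec₂_mem_degenerate (.inl rfl), ?_⟩
    change D.toSSet.δ 2 (D.toSSet.map (vec₂ a' a' c' h₁' h₂').op β) ∈ _
    rw [δ_map, δ₂_vec₂]
    exact map_vec₁_mem_degenerate _ _

/-- This is where an inverse enters: the edge `ab` of `α` may be degenerate although `a ≠ b`, as for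
the long edge of a triangle exhibiting an inverse. -/
theorem tri₂_mem_grayTriangles_of_left (hα : α ∈ C.core.obj (op ⦋m⦌))
    (hβ : β ∈ D.core.obj (op ⦋k⦌)) {a b : Fin (m + 1)} {a' b' c' : Fin (k + 1)} {h₁ : a ≤ b}
    {h₁' : a' ≤ b'} {h₂' : b' ≤ c'}
    (h : C.toSSet.map (vec₁ a b h₁).op α ∈ C.toSSet.degenerate 1) :
    tri₂ α β a a b a' b' c' le_rfl h₁ h₁' h₂' ∈ grayTriangles C D := by
  refine ⟨⟨hα _, hβ _⟩, Or.inl ⟨map_vec₂_mem_degenerate (.inl rfl), ?_⟩⟩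
  change C.toSSet.δ 0 (C.toSSet.map (vec₂ a a b _ h₁).op α) ∈ _
  rw [δ_map, δ₀_vec₂]
  exact h

theorem tri₂_mem_grayTriangles_of_right (hα : α ∈ C.core.obj (op ⦋m⦌))
    (hβ : β ∈ D.core.obj (op ⦋k⦌)) {a b c : Fin (m + 1)} {a' b' : Fin (k + 1)} {h₁ : a ≤ b}
    {h₂ : b ≤ c} {h₁' : a' ≤ b'}
    (h : D.toSSet.map (vec₁ a' b' h₁').op β ∈ D.toSSet.degenerate 1) :
    tri₂ α β a b c a' b' b' h₁ h₂ h₁' le_rfl ∈ grayTriangles C D := by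
  refine ⟨⟨hα _, hβ _⟩, Or.inr ⟨map_vec₂_mem_degenerate (.inr rfl), ?_⟩⟩
  change D.toSSet.δ 2 (D.toSSet.map (vec₂ a' b' b' h₁' _).op β) ∈ _
  rw [δ_map, δ₂_vec₂]
  exact h

/-! ### Triangles of a product and squares of edges -/

variable (hF : ∀ t ∈ grayTriangles C D, IsStable F (isomorphisms _) t)

include hF in
theorem isStable_of_squareTriangle_left {α : C.toSSet _⦋2⦌} {β : D.toSSet _⦋2⦌}
    (hα : α ∈ C.core.obj (op ⦋2⦌)) (hβ : β ∈ D.core.obj (op ⦋2⦌))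
    (h : ∀ r, IsStable F (isomorphisms _)
      (squareTriangle (C.toSSet.map (vec₁ 1 2).op α) r)) :
    IsStable F (isomorphisms _) (tri₂ α β 0 1 2 0 1 2) := by
  -- The first tetrahedron 00, 10, 12, 22 yields the triangle 00, 12, 22 from the square of `α₁₂`
  -- and `β₀₂`. The second, 00, 11, 12, 22, yields 00, 11, 22 from that triangle and the square of
  -- `α₁₂` and `β₁₂`. All other faces are Gray thin.
  have h₁ := isStable_δ₁ (F := F) (s := tetra α β 0 1 1 2 0 0 2 2)
  have h₂ := isStable_δ₂ (F := F) (s := tetra α β 0 1 1 2 0 1 2 2)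
  simp only [δ₀_tetra, δ₁_tetra, δ₂_tetra, δ₃_tetra] at h₁ h₂
  refine h₂ (hF _ (tri₂_mem_grayTriangles hα hβ (.inl rfl)))
    (h₁ (hF _ (tri₂_mem_grayTriangles hα hβ (.inl rfl)))
      (hF _ (tri₂_mem_grayTriangles hα hβ (.inr rfl))) ?_) ?_
  · have := h (D.toSSet.map (vec₁ 0 2).op β)
    rwa [squareTriangle_map] at this
  · have := h (D.toSSet.map (vec₁ 1 2).op β)
    rwa [squareTriangle_map] at this

include hF in
theorem isStable_of_squareTriangle_right {α : C.toSSet _⦋2⦌} {β : D.toSSet _⦋2⦌}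
    (hα : α ∈ C.core.obj (op ⦋2⦌)) (hβ : β ∈ D.core.obj (op ⦋2⦌))
    (h : ∀ g, IsStable F (isomorphisms _)
      (squareTriangle g (D.toSSet.map (vec₁ 0 1).op β))) :
    IsStable F (isomorphisms _) (tri₂ α β 0 1 2 0 1 2) := by
  -- The tetrahedron 00, 01, 21, 22 yields 00, 01, 22 from the square of `α₀₂` and `β₀₁`; then 00,
  -- 01, 11, 22 yields 00, 11, 22 using the square of `α₀₁` and `β₀₁`.
  have h₁ := isStable_δ₂ (F := F) (s := tetra α β 0 0 2 2 0 1 1 2)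
  have h₂ := isStable_δ₁ (F := F) (s := tetra α β 0 0 1 2 0 1 1 2)
  simp only [δ₀_tetra, δ₁_tetra, δ₂_tetra, δ₃_tetra] at h₁ h₂
  refine h₂ ?_ (h₁ ?_ (hF _ (tri₂_mem_grayTriangles hα hβ (.inl rfl)))
    (hF _ (tri₂_mem_grayTriangles hα hβ (.inl rfl))))
    (hF _ (tri₂_mem_grayTriangles hα hβ (.inr rfl)))
  · have := h (C.toSSet.map (vec₁ 0 1).op α)
    rwa [squareTriangle_map] at this
  · have := h (C.toSSet.map (vec₁ 0 2).op α)
    rwa [squareTriangle_map] at this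

include hF in
-- Pasting the squares of `α₀₁` and `α₁₂` along `r` gives the square of the degenerate edge `α₀₂`,
-- which is invertible. Of the two pasted cells, the one applied first is a split monomorphism and
-- the other a split epimorphism; each appears whiskered by the other edge of `α`.
theorem isStable_squareTriangle_comp_left {α : C.toSSet _⦋2⦌} (hα : α ∈ C.core.obj (op ⦋2⦌))
    (hα' : C.toSSet.map (vec₁ 0 2).op α ∈ C.toSSet.degenerate 1) (r : D.toSSet _⦋1⦌) :
    IsStableRight F (splitEpis _) (squareTriangle (C.toSSet.map (vec₁ 0 1).op α) r)
        (edge₂ α r 1 2 1 1) ∧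
      IsStableLeft F (splitMonos _) (edge₂ α r 0 1 0 0)
        (squareTriangle (C.toSSet.map (vec₁ 1 2).op α) r) := by
  have hr := D.mem_core_edge r
  -- In 00, 01, 11, 21 the face 00, 01, 21 is thin because `α₀₂` is degenerate. The face 00, 11, 21
  -- is then a split monomorphism, and the tetrahedron 00, 10, 11, 21 identifies it, up to
  -- isomorphism, with the whiskered square of `α₁₂`.
  have h₁ := isStable_splitMonos_δ₁ (F := F) (s := tetra α r 0 0 1 2 0 1 1 1)
  have h₂ := isStable_δ₁_iff (F := F) (Q := splitMonos _) (s := tetra α r 0 1 1 2 0 0 1 1)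
  simp only [δ₀_tetra, δ₁_tetra, δ₂_tetra, δ₃_tetra, fst_edge_tetra, snd_edge_tetra] at h₁ h₂
  have h₃ := h₁ (hF _ (tri₂_mem_grayTriangles_of_left hα hr hα'))
    (hF _ (tri₂_mem_grayTriangles hα hr (.inr rfl)))
  have h₄ := (h₂ (hF _ (tri₂_mem_grayTriangles hα hr (.inl rfl)))
    (hF _ (tri₂_mem_grayTriangles hα hr (.inr rfl)))).1 h₃.1
  have e : D.toSSet.map (vec₁ 0 1).op r = r := by
    have : vec₁ (0 : Fin 2) 1 = 𝟙 _ := hom_ext_apply fun i ↦ by fin_cases i <;> rfl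
    simp [this]
  constructor
  · have := h₃.2
    rwa [← squareTriangle_map, e] at this
  · rwa [← squareTriangle_map, e] at h₄

include hF in
-- The pasting is now in the direction of `D`. The square of the first edge of `β` is the cell
-- applied first, so compared with `isStable_squareTriangle_comp_left` split monomorphisms and split
-- epimorphisms are exchanged.
theorem isStable_squareTriangle_comp_right {β : D.toSSet _⦋2⦌} (hβ : β ∈ D.core.obj (op ⦋2⦌))
    (hβ' : D.toSSet.map (vec₁ 0 2).op β ∈ D.toSSet.degenerate 1) (g : C.toSSet _⦋1⦌) :
    IsStableRight F (splitMonos _) (squareTriangle g (D.toSSet.map (vec₁ 0 1).op β))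
        (edge₂ g β 1 1 1 2) ∧
      IsStableLeft F (splitEpis _) (edge₂ g β 0 0 0 1)
        (squareTriangle g (D.toSSet.map (vec₁ 1 2).op β)) := by
  have hg := C.mem_core_edge g
  have h₁ := isStable_splitMonos_δ₂ (F := F) (s := tetra g β 0 0 0 1 0 1 2 2)
  have h₂ := isStable_δ₂_iff (F := F) (Q := splitMonos _) (s := tetra g β 0 0 1 1 0 1 1 2)
  simp only [δ₀_tetra, δ₁_tetra, δ₂_tetra, δ₃_tetra, fst_edge_tetra, snd_edge_tetra] at h₁ h₂
  have h₃ := h₁ (hF _ (tri₂_mem_grayTriangles_of_right hg hβ hβ'))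
    (hF _ (tri₂_mem_grayTriangles hg hβ (.inl rfl)))
  have h₄ := (h₂ (hF _ (tri₂_mem_grayTriangles hg hβ (.inl rfl)))
    (hF _ (tri₂_mem_grayTriangles hg hβ (.inl rfl)))).1 h₃.1
  have e : C.toSSet.map (vec₁ 0 1).op g = g := by
    have : vec₁ (0 : Fin 2) 1 = 𝟙 _ := hom_ext_apply fun i ↦ by fin_cases i <;> rfl
    simp [this]
  constructor
  · rwa [← squareTriangle_map, e] at h₄
  · have := h₃.2
    rwa [← squareTriangle_map, e] at this

end

end ScaledSSet

namespace ScaledSSet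

open SimplexCategory

/-! ### The core of an `∞`-bicategory -/

variable {C : ScaledSSet.{u}}

theorem eq_vec₂ {m : ℕ} (φ : ⦋2⦌ ⟶ ⦋m⦌) :
    φ = vec₂ (φ.toOrderHom 0) (φ.toOrderHom 1) (φ.toOrderHom 2)
      (φ.toOrderHom.monotone (by decide)) (φ.toOrderHom.monotone (by decide)) :=
  hom_ext_apply fun i ↦ by fin_cases i <;> rfl

theorem mem_core_iff {m : ℕ} {s : C.toSSet _⦋m⦌} :
    s ∈ C.core.obj (op ⦋m⦌) ↔ ∀ (a b c : Fin (m + 1)) (h : a < b) (h' : b < c),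
      C.toSSet.map (vec₂ a b c h.le h'.le).op s ∈ C.thin := by
  refine ⟨fun h _ _ _ _ _ ↦ h _, fun h φ ↦ ?_⟩
  rw [eq_vec₂ φ]
  by_cases h₁ : φ.toOrderHom 0 = φ.toOrderHom 1
  · exact C.degenerate_le (map_vec₂_mem_degenerate (.inl h₁))
  by_cases h₂ : φ.toOrderHom 1 = φ.toOrderHom 2
  · exact C.degenerate_le (map_vec₂_mem_degenerate (.inr h₂))
  exact h _ _ _ (lt_of_le_of_ne (φ.toOrderHom.monotone (by decide)) h₁)
    (lt_of_le_of_ne (φ.toOrderHom.monotone (by decide)) h₂)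

theorem mem_core_of_thin {t : C.toSSet _⦋2⦌} (ht : t ∈ C.thin) : t ∈ C.core.obj (op ⦋2⦌) := by
  rw [mem_core_iff]
  intro a b c h h'
  obtain rfl : a = 0 := by lia
  obtain rfl : b = 1 := by lia
  obtain rfl : c = 2 := by lia
  have : vec₂ (0 : Fin 3) 1 2 h.le h'.le = 𝟙 _ := hom_ext_apply fun i ↦ by fin_cases i <;> rfl
  rw [this]
  simpa using ht

theorem thin_of_mem_core {t : C.toSSet _⦋2⦌} (ht : t ∈ C.core.obj (op ⦋2⦌)) : t ∈ C.thin := by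
  simpa using ht (𝟙 _)

theorem mem_core_of_δ {s : C.toSSet _⦋3⦌} (h : ∀ i : Fin 4, C.toSSet.δ i s ∈ C.thin) :
    s ∈ C.core.obj (op ⦋3⦌) := by
  rw [mem_core_iff]
  intro a b c h₁ h₂
  have key (i : Fin 4) (hi : δ i = vec₂ a b c h₁.le h₂.le) :
      C.toSSet.map (vec₂ a b c h₁.le h₂.le).op s ∈ C.thin := hi ▸ h i
  fin_cases a <;> fin_cases b <;> (try exact absurd h₁ (by decide)) <;> fin_cases c <;>
    (try exact absurd h₂ (by decide))
  · exact key 3 (hom_ext_apply fun i ↦ by fin_cases i <;> rfl)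
  · exact key 2 (hom_ext_apply fun i ↦ by fin_cases i <;> rfl)
  · exact key 1 (hom_ext_apply fun i ↦ by fin_cases i <;> rfl)
  · exact key 0 (hom_ext_apply fun i ↦ by fin_cases i <;> rfl)

theorem yonedaEquiv_symm_app_mem_of_mem_tri {X : SSet.{u}} {T : Set (X _⦋2⦌)} {n a b c : ℕ}
    (s : X _⦋n⦌) {t : (Δ[n] : SSet.{u}) _⦋2⦌} (ht : t ∈ tri n a b c) (φ : ⦋2⦌ ⟶ ⦋n⦌)
    (h : X.map φ.op s ∈ T) (h₀ : (φ.toOrderHom 0 : ℕ) = a) (h₁ : (φ.toOrderHom 1 : ℕ) = b)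
    (h₂ : (φ.toOrderHom 2 : ℕ) = c) :
    (SSet.yonedaEquiv.symm s).app _ t ∈ T := by
  obtain ⟨ht₀, ht₁, ht₂⟩ := ht
  obtain rfl : t = SSet.stdSimplex.objEquiv.symm φ := by
    apply SSet.stdSimplex.ext
    intro i
    rw [Fin.ext_iff]
    fin_cases i
    exacts [ht₀.trans h₀.symm, ht₁.trans h₁.symm, ht₂.trans h₂.symm]
  exact h

theorem mem_tri_vec₂ {n : ℕ} (a b c : Fin (n + 1)) (h : a ≤ b) (h' : b ≤ c) :
    (SSet.stdSimplex.objEquiv.symm (vec₂ a b c h h') : (Δ[n] : SSet.{u}) _⦋2⦌) ∈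
      tri n a b c :=
  ⟨rfl, rfl, rfl⟩

section

variable (hC : C.IsInftyBicategory)

include hC

theorem thin_of_satTriangles {s : C.toSSet _⦋4⦌}
    (h₁ : C.toSSet.map (vec₂ 0 2 4).op s ∈ C.thin)
    (h₂ : C.toSSet.map (vec₂ 1 2 3).op s ∈ C.thin)
    (h₃ : C.toSSet.map (vec₂ 0 1 3).op s ∈ C.thin)
    (h₄ : C.toSSet.map (vec₂ 1 3 4).op s ∈ C.thin)
    (h₅ : C.toSSet.map (vec₂ 0 1 2).op s ∈ C.thin) :
    C.toSSet.map (vec₂ 0 3 4).op s ∈ C.thin ∧ C.toSSet.map (vec₂ 0 1 4).op s ∈ C.thin := by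
  let f : ofTriangles.{u} Δ[4] satTriangles ⟶ C :=
    { hom := SSet.yonedaEquiv.symm s
      map_thin := by
        rintro t (((((ht | ht) | ht) | ht) | ht) | ht)
        · exact yonedaEquiv_symm_app_mem_of_mem_tri s ht _ h₁ rfl rfl rfl
        · exact yonedaEquiv_symm_app_mem_of_mem_tri s ht _ h₂ rfl rfl rfl
        · exact yonedaEquiv_symm_app_mem_of_mem_tri s ht _ h₃ rfl rfl rfl
        · exact yonedaEquiv_symm_app_mem_of_mem_tri s ht _ h₄ rfl rfl rfl
        · exact yonedaEquiv_symm_app_mem_of_mem_tri s ht _ h₅ rfl rfl rfl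
        · exact C.degenerate_le (SSet.app_mem_degenerate _ ht) }
  obtain ⟨g, hg⟩ := hC satIncl .saturation f
  have hg' : g.hom = SSet.yonedaEquiv.symm s := congrArg Hom.hom hg
  have key (t) (ht : t ∈ (ofTriangles.{u} Δ[4]
      (satTriangles ∪ (tri 4 0 3 4 ∪ tri 4 0 1 4))).thin) := g.map_thin t ht
  simp only [hg'] at key
  exact ⟨key _ (.inl (.inr (.inl (mem_tri_vec₂ 0 3 4 (by decide) (by decide))))),
    key _ (.inl (.inr (.inr (mem_tri_vec₂ 0 1 4 (by decide) (by decide)))))⟩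

/-- Saturation applied to the degenerate 4-simplex with vertices 0, 1, 1, 2, 3: its five given
triangles are the three known faces and two degenerate ones, and its triangle 034 is the missing
face. -/
theorem thin_δ₁ {s : C.toSSet _⦋3⦌} (h₀ : C.toSSet.δ 0 s ∈ C.thin)
    (h₂ : C.toSSet.δ 2 s ∈ C.thin) (h₃ : C.toSSet.δ 3 s ∈ C.thin) :
    C.toSSet.δ 1 s ∈ C.thin := by
  have key (a b c : Fin 5) (h : a ≤ b) (h' : b ≤ c) (φ : ⦋2⦌ ⟶ ⦋3⦌)
      (hφ : vec₂ a b c h h' ≫ σ (n := 3) 1 = φ) :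
      C.toSSet.map (vec₂ a b c h h').op (C.toSSet.σ 1 s) = C.toSSet.map φ.op s := by
    rw [← hφ, op_comp, Functor.map_comp_apply]
    rfl
  have h := thin_of_satTriangles hC (s := C.toSSet.σ 1 s)
  rw [key 0 2 4 _ _ (δ 2) (by decide), key 1 2 3 _ _ (vec₂ 1 1 2) (by decide),
    key 0 1 3 _ _ (δ 3) (by decide), key 1 3 4 _ _ (δ 0) (by decide),
    key 0 1 2 _ _ (vec₂ 0 1 1) (by decide), key 0 3 4 _ _ (δ 1) (by decide)] at h
  exact (h h₂ (C.degenerate_le (map_vec₂_mem_degenerate (.inl rfl))) h₃ h₀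
    (C.degenerate_le (map_vec₂_mem_degenerate (.inr rfl)))).1

/-- Saturation applied to the vertices 0, 1, 2, 2, 3; the missing face is now the triangle 014. -/
theorem thin_δ₂ {s : C.toSSet _⦋3⦌} (h₀ : C.toSSet.δ 0 s ∈ C.thin)
    (h₁ : C.toSSet.δ 1 s ∈ C.thin) (h₃ : C.toSSet.δ 3 s ∈ C.thin) :
    C.toSSet.δ 2 s ∈ C.thin := by
  have key (a b c : Fin 5) (h : a ≤ b) (h' : b ≤ c) (φ : ⦋2⦌ ⟶ ⦋3⦌)
      (hφ : vec₂ a b c h h' ≫ σ (n := 3) 2 = φ) :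
      C.toSSet.map (vec₂ a b c h h').op (C.toSSet.σ 2 s) = C.toSSet.map φ.op s := by
    rw [← hφ, op_comp, Functor.map_comp_apply]
    rfl
  have h := thin_of_satTriangles hC (s := C.toSSet.σ 2 s)
  rw [key 0 2 4 _ _ (δ 1) (by decide), key 1 2 3 _ _ (vec₂ 1 2 2) (by decide),
    key 0 1 3 _ _ (δ 3) (by decide), key 1 3 4 _ _ (δ 0) (by decide),
    key 0 1 2 _ _ (δ 3) (by decide), key 0 1 4 _ _ (δ 2) (by decide)] at h
  exact (h h₁ (C.degenerate_le (map_vec₂_mem_degenerate (.inr rfl))) h₃ h₀ h₃).2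

theorem exists_filler_of_innerHorn {n : ℕ} {i : Fin (n + 2)} (h₀ : 0 < i.val)
    (h₁ : i.val < n + 1) (g : (Λ[n + 1, i] : SSet.{u}) ⟶ C.core.toSSet) :
    ∃ s : C.toSSet _⦋n + 1⦌,
      (∀ j (hj : j ≠ i), C.toSSet.δ j s =
        (SSet.yonedaEquiv (SSet.horn.ι i j hj ≫ g)).val) ∧
      ∀ φ : ⦋2⦌ ⟶ ⦋n + 1⦌, (φ.toOrderHom 0 : ℕ) = i.val - 1 → (φ.toOrderHom 1 : ℕ) = i.val →
        (φ.toOrderHom 2 : ℕ) = i.val + 1 → C.toSSet.map φ.op s ∈ C.thin := by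
  let f : ofTriangles Λ[n + 1, i].toSSet
      (restrict Λ[n + 1, i] (tri (n + 1) (i.val - 1) i.val (i.val + 1))) ⟶ C :=
    { hom := g ≫ C.core.ι
      map_thin := fun t _ ↦ thin_of_mem_core (g.app _ t).2 }
  obtain ⟨k, hk⟩ := hC _ (.innerHorn (n + 1) i h₀ h₁) f
  let k' : (Δ[n + 1] : SSet.{u}) ⟶ C.toSSet := k.hom
  have hk' : Λ[n + 1, i].ι ≫ k' = g ≫ C.core.ι := congrArg Hom.hom hk
  refine ⟨SSet.yonedaEquiv k', fun j hj ↦ ?_, fun φ hφ₀ hφ₁ hφ₂ ↦ ?_⟩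
  · have h : SSet.stdSimplex.δ j ≫ k' = (SSet.horn.ι i j hj ≫ g) ≫ C.core.ι := by
      rw [← SSet.horn.ι_ι i j hj, Category.assoc, hk', Category.assoc]
    exact (SSet.stdSimplex.yonedaEquiv_δ_comp k' j).symm.trans (congrArg SSet.yonedaEquiv h)
  · have := k.map_thin (SSet.stdSimplex.objEquiv.symm φ) (.inl ⟨hφ₀, hφ₁, hφ₂⟩)
    obtain ⟨s, hs⟩ := SSet.yonedaEquiv.symm.surjective k'
    rw [← hs, Equiv.apply_symm_apply]
    change k'.app _ _ ∈ C.thin at this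
    rw [← hs] at this
    exact this

end

end ScaledSSet

/-! ### Inverse edges in 2-truncated quasi-categories -/

namespace SSet

/-- The truncation of a simplicial set is a `2`-truncated quasicategory if inner horns of
dimensions `2` and `3` have fillers. -/
theorem quasicategory₂_of_exists_filler {X : SSet.{u}}
    (h : ∀ (n : ℕ) (_ : n ≤ 1) (i : Fin (n + 3)) (_ : 0 < i.val) (_ : i.val < n + 2)
      (g : (Λ[n + 2, i] : SSet.{u}) ⟶ X),
      ∃ s : X _⦋n + 2⦌, ∀ j (hj : j ≠ i), X.δ j s = SSet.yonedaEquiv (horn.ι i j hj ≫ g)) :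
    Truncated.Quasicategory₂ ((truncation 2).obj X) where
  fill21 {x₀ x₁ x₂} e₀₁ e₁₂ := by
    let a₂ : X _⦋1⦌ := e₀₁.edge
    let a₀ : X _⦋1⦌ := e₁₂.edge
    have h₁ : X.δ 0 a₂ = X.δ 1 a₀ := e₀₁.tgt_eq.trans e₁₂.src_eq.symm
    have w : stdSimplex.δ 0 ≫ yonedaEquiv.symm a₂ = stdSimplex.δ 1 ≫ yonedaEquiv.symm a₀ := by
      rw [stdSimplex.δ_comp_yonedaEquiv_symm, stdSimplex.δ_comp_yonedaEquiv_symm, h₁]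
    obtain ⟨s, hs⟩ := h 0 (by lia) 1 (by decide) (by decide) (horn₂₁.isPushout.desc _ _ w)
    have h₂ : X.δ 2 s = a₂ := (hs 2 (by decide)).trans <| by
      rw [horn₂₁.isPushout.inl_desc, Equiv.apply_symm_apply]
    have h₀ : X.δ 0 s = a₀ := (hs 0 (by decide)).trans <| by
      rw [horn₂₁.isPushout.inr_desc, Equiv.apply_symm_apply]
    refine ⟨⟨⟨X.δ 1 s, ?_, ?_⟩, ⟨s, h₂, h₀, rfl⟩⟩⟩
    · have := ConcreteCategory.congr_hom (X.δ_comp_δ (i := 1) (j := 1) le_rfl) s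
      exact this.symm.trans ((congrArg (X.δ 1) h₂).trans e₀₁.src_eq)
    · have := ConcreteCategory.congr_hom (X.δ_comp_δ (i := 0) (j := 0) le_rfl) s
      exact this.trans ((congrArg (X.δ 0) h₀).trans e₁₂.tgt_eq)
  fill31 {x₀ x₁ x₂ x₃} e₀₁ e₁₂ e₂₃ e₀₂ e₁₃ e₀₃ f₃ f₀ f₂ := by
    let a₃ : X _⦋2⦌ := f₃.simplex
    let a₀ : X _⦋2⦌ := f₀.simplex
    let a₂ : X _⦋2⦌ := f₂.simplex
    have w (i j : Fin 3) {a b : X _⦋2⦌} (h : X.δ i a = X.δ j b) :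
        stdSimplex.δ i ≫ yonedaEquiv.symm a = stdSimplex.δ j ≫ yonedaEquiv.symm b := by
      rw [stdSimplex.δ_comp_yonedaEquiv_symm, stdSimplex.δ_comp_yonedaEquiv_symm, h]
    have w₁ := w 2 0 (a := a₀) (b := a₃) (f₀.d₂.trans f₃.d₀.symm)
    have w₂ := w 1 0 (a := a₀) (b := a₂) (f₀.d₁.trans f₂.d₀.symm)
    have w₃ := w 2 2 (a := a₂) (b := a₃) (f₂.d₂.trans f₃.d₂.symm)
    obtain ⟨s, hs⟩ := h 1 le_rfl 1 (by decide) (by decide) (horn₃₁.desc _ _ _ w₁ w₂ w₃)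
    have h₀ : X.δ 0 s = a₀ := (hs 0 (by decide)).trans <| by
      rw [horn₃₁.ι₀_desc, Equiv.apply_symm_apply]
    have h₂ : X.δ 2 s = a₂ := (hs 2 (by decide)).trans <| by
      rw [horn₃₁.ι₂_desc, Equiv.apply_symm_apply]
    have h₃ : X.δ 3 s = a₃ := (hs 3 (by decide)).trans <| by
      rw [horn₃₁.ι₃_desc, Equiv.apply_symm_apply]
    refine ⟨⟨X.δ 1 s, ?_, ?_, ?_⟩⟩
    · have := ConcreteCategory.congr_hom (X.δ_comp_δ (i := 1) (j := 2) (by decide)) s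
      exact this.symm.trans ((congrArg (X.δ 1) h₃).trans f₃.d₁)
    · have := ConcreteCategory.congr_hom (X.δ_comp_δ (i := 0) (j := 0) le_rfl) s
      exact this.trans ((congrArg (X.δ 0) h₀).trans f₀.d₀)
    · have := ConcreteCategory.congr_hom (X.δ_comp_δ (i := 1) (j := 1) le_rfl) s
      exact this.symm.trans ((congrArg (X.δ 1) h₂).trans f₂.d₁)
  fill32 {x₀ x₁ x₂ x₃} e₀₁ e₁₂ e₂₃ e₀₂ e₁₃ e₀₃ f₃ f₀ f₁ := by
    let a₃ : X _⦋2⦌ := f₃.simplex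
    let a₀ : X _⦋2⦌ := f₀.simplex
    let a₁ : X _⦋2⦌ := f₁.simplex
    have w (i j : Fin 3) {a b : X _⦋2⦌} (h : X.δ i a = X.δ j b) :
        stdSimplex.δ i ≫ yonedaEquiv.symm a = stdSimplex.δ j ≫ yonedaEquiv.symm b := by
      rw [stdSimplex.δ_comp_yonedaEquiv_symm, stdSimplex.δ_comp_yonedaEquiv_symm, h]
    have w₁ := w 2 0 (a := a₀) (b := a₃) (f₀.d₂.trans f₃.d₀.symm)
    have w₂ := w 0 0 (a := a₀) (b := a₁) (f₀.d₀.trans f₁.d₀.symm)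
    have w₃ := w 2 1 (a := a₁) (b := a₃) (f₁.d₂.trans f₃.d₁.symm)
    obtain ⟨s, hs⟩ := h 1 le_rfl 2 (by decide) (by decide) (horn₃₂.desc _ _ _ w₃ w₁ w₂)
    have h₀ : X.δ 0 s = a₀ := (hs 0 (by decide)).trans <| by
      rw [horn₃₂.ι₀_desc, Equiv.apply_symm_apply]
    have h₁ : X.δ 1 s = a₁ := (hs 1 (by decide)).trans <| by
      rw [horn₃₂.ι₁_desc, Equiv.apply_symm_apply]
    have h₃ : X.δ 3 s = a₃ := (hs 3 (by decide)).trans <| by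
      rw [horn₃₂.ι₃_desc, Equiv.apply_symm_apply]
    refine ⟨⟨X.δ 2 s, ?_, ?_, ?_⟩⟩
    · have := ConcreteCategory.congr_hom (X.δ_comp_δ (i := 2) (j := 2) le_rfl) s
      exact this.symm.trans ((congrArg (X.δ 2) h₃).trans f₃.d₂)
    · have := ConcreteCategory.congr_hom (X.δ_comp_δ (i := 0) (j := 1) (by decide)) s
      exact this.trans ((congrArg (X.δ 1) h₀).trans f₀.d₁)
    · have := ConcreteCategory.congr_hom (X.δ_comp_δ (i := 1) (j := 1) le_rfl) s
      exact this.trans ((congrArg (X.δ 1) h₁).trans f₁.d₁)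

namespace Truncated

variable (A : Truncated.{u} 2) [Quasicategory₂ A]

/-- The comparison functor between the two constructions of the homotopy category. -/
noncomputable def homotopyCategoryToHomotopyCategory₂ :
    A.HomotopyCategory ⥤ HomotopyCategory₂ A :=
  HomotopyCategory.lift (fun x ↦ HomotopyCategory₂.mk x) (fun e ↦ HomotopyCategory₂.homMk e)
    (fun _ ↦ rfl) (fun s ↦ s.homotopyCategory₂_fac)

variable {A}

theorem homotopyCategoryToHomotopyCategory₂_map_homMk {x y : A.obj (op ⟨⦋0⦌, by decide⟩)}
    (e : Edge x y) :
    (homotopyCategoryToHomotopyCategory₂ A).map (HomotopyCategory.homMk e) =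
      HomotopyCategory₂.homMk e :=
  HomotopyCategory.lift_map_homMk _ _ _ _ e

/-- In the homotopy category given by generators and relations an inverse is only a formal composite
of edges. In `HomotopyCategory₂` every morphism is the class of one edge and relations between
composites are witnessed by triangles, so the isomorphism is transported there. -/
theorem exists_inverse_of_isIso_homMk {x y : A.obj (op ⟨⦋0⦌, by decide⟩)} (e : Edge x y)
    (he : IsIso (HomotopyCategory.homMk e)) :
    ∃ e' : Edge y x, Nonempty (Edge.CompStruct e e' (Edge.id x)) ∧
      Nonempty (Edge.CompStruct e' e (Edge.id y)) := by
  have : IsIso (HomotopyCategory₂.homMk e) := by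
    rw [← homotopyCategoryToHomotopyCategory₂_map_homMk]
    exact Functor.map_isIso (homotopyCategoryToHomotopyCategory₂ A) (HomotopyCategory.homMk e)
  obtain ⟨e', he'⟩ := HomotopyCategory₂.homMk_surjective (inv (HomotopyCategory₂.homMk e))
  refine ⟨e', Edge.CompStruct.nonempty_iff.2 ?_, Edge.CompStruct.nonempty_iff.2 ?_⟩
  · rw [he', IsIso.hom_inv_id]
    rfl
  · rw [he', IsIso.inv_hom_id]
    rfl

end Truncated

end SSet

/-! ### Inverses of invertible edges of an `∞`-bicategory -/

namespace ScaledSSet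

open SimplexCategory

variable {C : ScaledSSet.{u}}

theorem IsInftyBicategory.quasicategory₂_core (hC : C.IsInftyBicategory) :
    SSet.Truncated.Quasicategory₂ ((SSet.truncation 2).obj C.core.toSSet) := by
  refine SSet.quasicategory₂_of_exists_filler fun n hn i h₀ h₁ g ↦ ?_
  obtain ⟨s, hs, hs'⟩ := exists_filler_of_innerHorn hC h₀ h₁ g
  suffices h : s ∈ C.core.obj (op ⦋n + 2⦌) from
    ⟨⟨s, h⟩, fun j hj ↦ Subtype.ext (hs j hj)⟩
  have hδ (j) (hj : j ≠ i) : C.toSSet.δ j s ∈ C.core.obj (op ⦋n + 1⦌) :=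
    (hs j hj).symm ▸ Subtype.property _
  obtain rfl | rfl : n = 0 ∨ n = 1 := by lia
  -- In dimension 2 the filler is itself the triangle required to be thin. In dimension 3 the three
  -- horn faces are thin because they lie in the core, and saturation gives the face opposite `i`.
  · obtain rfl : i = 1 := by lia
    exact mem_core_of_thin (by simpa using hs' (𝟙 _) rfl rfl rfl)
  · have hδ' (j : Fin 4) (hj : j ≠ i) : C.toSSet.δ j s ∈ C.thin := thin_of_mem_core (hδ j hj)
    refine mem_core_of_δ fun j ↦ ?_
    by_cases hj : j = i
    · subst hj
      obtain rfl | rfl : j = 1 ∨ j = 2 := by lia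
      · exact thin_δ₁ hC (hδ' 0 (by decide)) (hδ' 2 (by decide)) (hδ' 3 (by decide))
      · exact thin_δ₂ hC (hδ' 0 (by decide)) (hδ' 1 (by decide)) (hδ' 3 (by decide))
    · exact hδ' j hj

theorem IsInvertible.exists_inverse (hC : C.IsInftyBicategory) {e : C.toSSet _⦋1⦌}
    (he : C.IsInvertible e) :
    ∃ α ∈ C.core.obj (op ⦋2⦌), ∃ α' ∈ C.core.obj (op ⦋2⦌),
      C.toSSet.map (vec₁ 0 1).op α = e ∧ C.toSSet.map (vec₁ 1 2).op α' = e ∧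
      C.toSSet.map (vec₁ 1 2).op α = C.toSSet.map (vec₁ 0 1).op α' ∧
      C.toSSet.map (vec₁ 0 2).op α ∈ C.toSSet.degenerate 1 ∧
      C.toSSet.map (vec₁ 0 2).op α' ∈ C.toSSet.degenerate 1 := by
  have := hC.quasicategory₂_core
  obtain ⟨e', ⟨s⟩, ⟨s'⟩⟩ := SSet.Truncated.exists_inverse_of_isIso_homMk _ he
  let t : C.core.toSSet _⦋2⦌ := s.simplex
  let t' : C.core.toSSet _⦋2⦌ := s'.simplex
  have h₀ : vec₁ (0 : Fin 3) 1 = δ 2 := hom_ext_apply fun i ↦ by fin_cases i <;> rfl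
  have h₁ : vec₁ (0 : Fin 3) 2 = δ 1 := hom_ext_apply fun i ↦ by fin_cases i <;> rfl
  have h₂ : vec₁ (1 : Fin 3) 2 = δ 0 := hom_ext_apply fun i ↦ by fin_cases i <;> rfl
  rw [h₀, h₁, h₂]
  refine ⟨t.1, t.2, t'.1, t'.2, congrArg Subtype.val s.d₂, congrArg Subtype.val s'.d₀,
    congrArg Subtype.val (s.d₀.trans s'.d₂.symm), ?_, ?_⟩
  · refine Set.mem_of_eq_of_mem (congrArg Subtype.val s.d₁) ?_
    exact SSet.σ_mem_degenerate _ _ _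
  · refine Set.mem_of_eq_of_mem (congrArg Subtype.val s'.d₁) ?_
    exact SSet.σ_mem_degenerate _ _ _

end ScaledSSet

/-! ### Squares with an invertible side -/

namespace ScaledSSet

open SimplexCategory MorphismProperty

section

variable {C D : SSet.{u}} {m k : ℕ} (α : C _⦋m⦌) (β : D _⦋k⦌) (a b c : Fin (m + 1))
  (a' b' c' : Fin (k + 1)) (h₁ : a ≤ b) (h₂ : b ≤ c) (h₁' : a' ≤ b') (h₂' : b' ≤ c')

theorem map_vec₁_zero_one_tri₂ : (C ⊗ D : SSet.{u}).map (vec₁ 0 1).op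
    (tri₂ α β a b c a' b' c' h₁ h₂ h₁' h₂') = edge₂ α β a b a' b' h₁ h₁' := by
  refine (map_bisimplex _ _ _ _ _).trans ?_
  congr 1 <;> exact hom_ext_apply fun i ↦ by fin_cases i <;> rfl

theorem map_vec₁_one_two_tri₂ : (C ⊗ D : SSet.{u}).map (vec₁ 1 2).op
    (tri₂ α β a b c a' b' c' h₁ h₂ h₁' h₂') = edge₂ α β b c b' c' h₂ h₂' := by
  refine (map_bisimplex _ _ _ _ _).trans ?_
  congr 1 <;> exact hom_ext_apply fun i ↦ by fin_cases i <;> rfl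

theorem map_vec₁_zero_two_tri₂ : (C ⊗ D : SSet.{u}).map (vec₁ 0 2).op
    (tri₂ α β a b c a' b' c' h₁ h₂ h₁' h₂') =
      edge₂ α β a c a' c' (h₁.trans h₂) (h₁'.trans h₂') := by
  refine (map_bisimplex _ _ _ _ _).trans ?_
  congr 1 <;> exact hom_ext_apply fun i ↦ by fin_cases i <;> rfl

theorem edge₂_mem_degenerate {α : C _⦋m⦌} {β : D _⦋k⦌} {a b : Fin (m + 1)} {a' b' : Fin (k + 1)}
    {h₁ : a ≤ b} {h₁' : a' ≤ b'}
    (h : C.map (vec₁ a b h₁).op α ∈ C.degenerate 1)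
    (h' : D.map (vec₁ a' b' h₁').op β ∈ D.degenerate 1) :
    edge₂ α β a b a' b' h₁ h₁' ∈ (C ⊗ D : SSet.{u}).degenerate 1 := by
  obtain ⟨v, hv⟩ := SSet.exists_of_mem_degenerate_one h
  obtain ⟨w, hw⟩ := SSet.exists_of_mem_degenerate_one h'
  exact ⟨0, by simp, σ 0, (v, w), Prod.ext hv hw⟩

theorem tri₂_zero_one_two (α : C _⦋2⦌) (β : D _⦋2⦌) : tri₂ α β 0 1 2 0 1 2 = (α, β) := by
  have e : vec₂ (0 : Fin 3) 1 2 = 𝟙 _ := hom_ext_apply fun i ↦ by fin_cases i <;> rfl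
  have h {X : SSet.{u}} (s : X _⦋2⦌) : X.map (vec₂ 0 1 2).op s = s := by simp [e]
  exact Prod.ext (h α) (h β)

end

section

variable {C D : ScaledSSet.{u}} {x y : C.toSSet.Vertex × D.toSSet.Vertex} {Z : SSet.{u}}
  {F : rigidHom (C.toSSet ⊗ D.toSSet) x y ⟶ Z}
  (hF : ∀ t ∈ grayTriangles C D, IsStable F (isomorphisms _) t)

include hF

theorem isStable_squareTriangle_of_left (hC : C.IsInftyBicategory) {g : C.toSSet _⦋1⦌}
    (hg : C.IsInvertible g) (r : D.toSSet _⦋1⦌) :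
    IsStable F (isomorphisms _) (squareTriangle g r) := by
  obtain ⟨α, hα, α', hα', h₁, h₂, h₃, h₄, h₅⟩ := hg.exists_inverse hC
  have hr := D.mem_core_edge r
  have h := (isStable_squareTriangle_comp_left hF hα h₄ r).1
  have h' := (isStable_squareTriangle_comp_left hF hα' h₅ r).2
  rw [h₁] at h
  rw [h₂] at h'
  -- In both halves the whiskering edge is the inverse of `g`. On the left it lies over vertex 0 of
  -- `r` and is cancelled by `α`, where it comes second; on the right it lies over vertex 1 and is
  -- cancelled by `α'`, where it comes first.
  refine isStable_iff_splitMonos_and_splitEpis.2 ⟨h'.cancel (u := tri₂ α r 0 1 2 0 0 0)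
      (hF _ (tri₂_mem_grayTriangles hα hr (.inr rfl))) ?_ ?_,
    h.cancel (u := tri₂ α' r 0 1 2 1 1 1)
      (hF _ (tri₂_mem_grayTriangles hα' hr (.inr rfl))) ?_ ?_⟩
  · exact (map_vec₁_one_two_tri₂ ..).trans (Prod.ext h₃ rfl)
  · rw [map_vec₁_zero_two_tri₂]
    exact edge₂_mem_degenerate h₄ (map_vec₁_mem_degenerate _ _)
  · exact (map_vec₁_zero_one_tri₂ ..).trans (Prod.ext h₃.symm rfl)
  · rw [map_vec₁_zero_two_tri₂]
    exact edge₂_mem_degenerate h₅ (map_vec₁_mem_degenerate _ _)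

theorem isStable_squareTriangle_of_right (hD : D.IsInftyBicategory) (g : C.toSSet _⦋1⦌)
    {r : D.toSSet _⦋1⦌} (hr : D.IsInvertible r) :
    IsStable F (isomorphisms _) (squareTriangle g r) := by
  obtain ⟨β, hβ, β', hβ', h₁, h₂, h₃, h₄, h₅⟩ := hr.exists_inverse hD
  have hg := C.mem_core_edge g
  have h := (isStable_squareTriangle_comp_right hF hβ h₄ g).1
  have h' := (isStable_squareTriangle_comp_right hF hβ' h₅ g).2
  rw [h₁] at h
  rw [h₂] at h'
  refine isStable_iff_splitMonos_and_splitEpis.2 ⟨h.cancel (u := tri₂ g β' 1 1 1 0 1 2)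
      (hF _ (tri₂_mem_grayTriangles hg hβ' (.inl rfl))) ?_ ?_,
    h'.cancel (u := tri₂ g β 0 0 0 0 1 2)
      (hF _ (tri₂_mem_grayTriangles hg hβ (.inl rfl))) ?_ ?_⟩
  · exact (map_vec₁_zero_one_tri₂ ..).trans (Prod.ext rfl h₃.symm)
  · rw [map_vec₁_zero_two_tri₂]
    exact edge₂_mem_degenerate (map_vec₁_mem_degenerate _ _) h₅
  · exact (map_vec₁_one_two_tri₂ ..).trans (Prod.ext rfl h₃)
  · rw [map_vec₁_zero_two_tri₂]
    exact edge₂_mem_degenerate (map_vec₁_mem_degenerate _ _) h₄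

theorem isStable_of_mem_invTriangles (hC : C.IsInftyBicategory) (hD : D.IsInftyBicategory)
    {t : (C.toSSet ⊗ D.toSSet : SSet.{u}) _⦋2⦌} (ht : t ∈ invTriangles C D) :
    IsStable F (isomorphisms _) t := by
  have e₀ : vec₁ (1 : Fin 3) 2 = δ 0 := hom_ext_apply fun i ↦ by fin_cases i <;> rfl
  have e₂ : vec₁ (0 : Fin 3) 1 = δ 2 := hom_ext_apply fun i ↦ by fin_cases i <;> rfl
  obtain ⟨α, β⟩ := t
  obtain ⟨⟨hα, hβ⟩, h⟩ := ht
  have ht : tri₂ (C := C.toSSet) (D := D.toSSet) α β 0 1 2 0 1 2 = (α, β) :=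
    tri₂_zero_one_two α β
  have hα' := mem_core_of_thin hα
  have hβ' := mem_core_of_thin hβ
  rw [← ht]
  obtain h | h := h
  · refine isStable_of_squareTriangle_left hF hα' hβ' fun r ↦
      isStable_squareTriangle_of_left hF hC ?_ r
    rw [e₀]
    exact h
  · refine isStable_of_squareTriangle_right hF hα' hβ' fun g ↦
      isStable_squareTriangle_of_right hF hD g ?_
    rw [e₂]
    exact h

end

end ScaledSSet

/-! ### From stable triangles to marked edges, and the theorem -/

namespace ScaledSSet

/-- On the mapping object where `F` is defined, whiskering by identities recovers the edge itself.
-/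
theorem isEquivalenceEdge_of_mem_stableEdges {X : SSet.{u}} {x y : X.Vertex} {Z : SSet.{u}}
    {F : rigidHom X x y ⟶ Z} {e : (rigidHom X x y) _⦋1⦌}
    (h : e ∈ stableEdges F (MorphismProperty.isomorphisms _)) :
    SSet.IsEquivalenceEdge (F.app _ e) := by
  have := h (rigidId _ _ x) (rigidId _ _ y)
  rwa [whisker_id_id] at this

/-- Induction on the generation of the marking. The endpoints `a` and `b` must vary, since the
factors of a composite live in other mapping objects than the one on which `F` is defined. -/
theorem IsRigidMarked.mem_stableEdges {X : ScaledSSet.{u}} {x y : X.toSSet.Vertex} {Z : SSet.{u}}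
    {F : rigidHom X.toSSet x y ⟶ Z}
    (h : ∀ t ∈ X.thin, IsStable F (MorphismProperty.isomorphisms _) t) {a b : X.toSSet.Vertex}
    {e : (rigidHom X.toSSet a b) _⦋1⦌} (he : IsRigidMarked X e) :
    e ∈ stableEdges F (MorphismProperty.isomorphisms _) := by
  induction he with
  | degenerate e he => exact mem_stableEdges_of_degenerate he
  | thin s hs => exact h s hs
  | comp _ _ iha ihb => exact rigidComp_mem_stableEdges iha ihb

theorem isEquivalenceEdge_of_isRigidMarked {C D : ScaledSSet.{u}} (hC : C.IsInftyBicategory)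
    (hD : D.IsInftyBicategory) {x y : (C.toSSet ⊗ D.toSSet : SSet.{u}).Vertex} {Z : SSet.{u}}
    {F : rigidHom (C.toSSet ⊗ D.toSSet) x y ⟶ Z}
    (hF : ∀ e ∈ ((gray C D).mor x y).marked, SSet.IsEquivalenceEdge (F.app _ e))
    {e : (rigidHom (C.toSSet ⊗ D.toSSet) x y) _⦋1⦌}
    (he : IsRigidMarked (ofTriangles (C.toSSet ⊗ D.toSSet) (invTriangles C D)) e) :
    SSet.IsEquivalenceEdge (F.app _ e) := by
  have hF' (t) (ht : t ∈ grayTriangles C D) :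
      IsStable F (MorphismProperty.isomorphisms _) t := isStable_of_mem_grayTriangles hF ht
  exact isEquivalenceEdge_of_mem_stableEdges <| IsRigidMarked.mem_stableEdges
    (X := ofTriangles (C.toSSet ⊗ D.toSSet) (invTriangles C D)) (fun t ht ↦
      ht.elim (isStable_of_mem_invTriangles hF' hC hD)
        (fun ht ↦ hF' t (degenerate_le_grayTriangles C D ht))) he

theorem EquivalentObjects.refl (X : ScaledSSet.{u}) (x : X.toSSet.Vertex) :
    X.EquivalentObjects x x :=
  ⟨rigidId _ _ x, rigidId _ _ x, by rw [rigidId_comp]; rfl, by rw [rigidId_comp]; rfl⟩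

end ScaledSSet

theorem propositionp (C D : ScaledSSet.{u}) (hC : C.IsInftyBicategory)
    (hD : D.IsInftyBicategory) :
    ScaledSSet.IsBicategoricalEquivalence (ScaledSSet.grayToInv C D) where
  markedEquivalence x y := by
    refine MarkedSSet.markedEquivalences_of_inverse _ (𝟙 _) ?_ ?_ fun Z φ hφ e he ↦
      ScaledSSet.isEquivalenceEdge_of_isRigidMarked hC hD hφ he
    · exact (Category.comp_id _).trans (ScaledSSet.rigidMap_id _ x y)
    · exact (Category.id_comp _).trans (ScaledSSet.rigidMap_id _ x y)
  -- The functor is the identity on objects.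
  essSurj y := ⟨y, .refl _ y⟩
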